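/- **Theorem (Invariance by cut elimination).** *Graphs and projects.* A directed weighted graph $G=(V_G,E_G,s_G,t_G,\omega_G)$ has a finite set $V_G$ of vertices, a countable set $E_G$ of edges, source and target maps $s_G,t_G:E_G\to V_G$ and weights $\omega_G:E_G\to\,]0,1]$. Graphs are considered up to renaming of edges: $G=H$ means $V_G=V_H$ and there is a bijection $E_G\to E_H$ preserving sources, targets and weights. $G\cup H$ has vertices $V_G\cup V_H$ and edges $E_G\uplus E_H$. An alternating path is a non-empty finite sequence of consecutive edges of $G\cup H$ taken alternately from $E_G$ and $E_H$; its weight is the product of the weights of its edges. The reduction $G\mathop{::}H$ has vertex set the symmetric difference $V_G\,\Delta\,V_H$ and, as edges, the alternating paths that begin and end in $V_G\,\Delta\,V_H$. An alternating cycle is an alternating path that ends where it begins and whose first and last edges come from different graphs. The set $\mathcal C(G,H)$ of alternating $1$-circuits consists of the alternating cycles that are not proper powers of another cycle, modulo cyclic permutation, and $$\langle G,H\rangle=\sum_{c\in\mathcal C(G,H)}-\log(1-\omega(c))\in[0,\infty]\qquad(-\log 0=\infty).$$ A project $\mathfrak a=(a,A)$ is a real $a\ge 0$ (wager) with a graph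 $A$; its carrier is $V_A$. Put $\ll\mathfrak a,\mathfrak b\gg\;=a+b+\langle A,B\rangle$. The tensor $\mathfrak a\otimes\mathfrak b=(a+b,A\cup B)$ is defined when $V_A\cap V_B=\emptyset$; the cut $\mathfrak a\mathop{::}\mathfrak b=(\ll\mathfrak a,\mathfrak b\gg,A\mathop{::}B)$ is defined when $\ll\mathfrak a,\mathfrak b\gg\;\ne\infty$. Projects of the same carrier are orthogonal when $\ll\mathfrak a,\mathfrak b\gg\;\notin\{0,\infty\}$, and a conduct of carrier $X$ is a non-empty set of projects of carrier $X$ equal to its biorthogonal. *The calculus.* Fix sizes $n_i\in\mathbb N$ ($i\in\mathbb N$). The localized variable $X_i(j)$ and its negation have location $\{(i,m)\mid jn_i\le m\le (j+1)n_i-1\}$; $\mathbf 1$ and $\bot$ have location $\emptyset$; $A\otimes B$ and $A⅋B$ are formulas when $A$ and $B$ have disjoint locations, and have the union as location. Negation is pushed to atoms by De Morgan's laws. Sequents are finite multisets of formulas with pairwise disjoint locations. The rules of locMLL are: the axiom $\vdash X_i(j)^\perp,X_i(j')$ ($j\ne j'$); the cut, from $\vdash A,\Delta$ and $\vdash A^\perp,\Gamma$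 to $\vdash\Delta,\Gamma$; $\otimes$, from $\vdash A,\Delta$ and $\vdash B,\Gamma$ to $\vdash A\otimes B,\Delta,\Gamma$; $⅋$, from $\vdash A,B,\Gamma$ to $\vdash A⅋B,\Gamma$; $\vdash\mathbf 1$; $\bot$, from $\vdash\Gamma$ to $\vdash\bot,\Gamma$; mix, from $\vdash\Gamma$ and $\vdash\Delta$ to $\vdash\Gamma,\Delta$. For $\otimes$ the locations of the two premises must be disjoint; for cut and mix those of $\Delta$ and $\Gamma$ must be. A proof of locMLL is a derivation in which each $X_i(j)$ and each $X_i(j)^\perp$ appears in at most one axiom rule. *Cut elimination.* The steps, applicable anywhere in a proof and with the premises of a cut read in either order, are: - a cut on $X_i(j')$ between the axioms $\vdash X_i(j)^\perp,X_i(j')$ and $\vdash X_i(j')^\perp,X_i(j'')$ ($j\neq j''$) becomes the axiom $\vdash X_i(j)^\perp,X_i(j'')$; - a cut between $A\otimes B$, introduced by $\otimes$ from $\pi_1\vdash A,\Delta_1$ and $\pi_2\vdash B,\Delta_2$, and $A^\perp⅋B^\perp$, introduced by $⅋$ from $\pi_3$, becomes a cut on $B$ of $\pi_2$ with the cut on $A$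 of $\pi_1$ with $\pi_3$; - a cut between the rule $\mathbf 1$ and a $\bot$ rule applied to $\pi_1$ becomes $\pi_1$; - a cut on $A$ one of whose premises ends with a $⅋$, $\otimes$, $\bot$, mix or cut rule having $A$ among the side formulas of a premise is moved above that rule, to that premise. *Interpretation.* A basis of interpretation $\Phi$ assigns to each $i$ a conduct $\Phi(X_i)$ of carrier $\{0,\dots,n_i-1\}\subset\mathbb N$. The project $I_\Phi(\pi)$ is defined by induction on $\pi$. An axiom $\vdash X_i(j)^\perp,X_i(j')$ is interpreted by wager $0$ with the graph having edges of weight $1$ in both directions between $(i,jn_i+x)$ and $(i,j'n_i+x)$, $0\le x<n_i$, on the vertices occurring there; the rule $\mathbf 1$ by $(0,\text{empty graph})$; a $⅋$ or $\bot$ rule leaves the project of the premise unchanged; $\otimes$ and mix are interpreted by the tensor of projects, and cut by the cut of projects. *Statement.* Let $\Phi$ be a basis of interpretation and $\pi$ a proof of $\vdash\Gamma$ in locMLL. 1. If all $n_i\geq 1$, then $\pi$ reduces by finitely many steps of cut elimination to some cut-free $\pi'$. 2. For arbitrary sizes, if $\pi'$ is any cut-free derivation tree obtained from $\pi$ by finitely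 many steps of cut elimination, then $\pi'$ is a proof of $\vdash\Gamma$ in locMLL, both $I_\Phi(\pi)$ and $I_\Phi(\pi')$ are defined, and $I_\Phi(\pi)=I_\Phi(\pi')$. -/

import Mathlib

namespace LocMLL

/-! ### Directed weighted graphs with located (named) vertices -/

/-- A directed weighted graph: a finite set of vertices taken from `α`, a countable set of edges,
source and target maps, and weights in `]0,1]`. -/
structure WGraph (α : Type) where
  V : Finset α
  E : Type
  countable_E : Countable E
  s : E → α
  t : E → α
  s_mem : ∀ e, s e ∈ V
  t_mem : ∀ e, t e ∈ V
  ω : E → Set.Ioc (0 : ℝ) 1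

namespace WGraph

variable {α : Type}

/-- Two graphs are identified when they have the very same vertices and differ only by a
renaming of their edges, i.e. a bijection preserving sources, targets and weights. -/
def Same (G H : WGraph α) : Prop :=
  G.V = H.V ∧ ∃ φ : G.E ≃ H.E,
    ∀ e, H.s (φ e) = G.s e ∧ H.t (φ e) = G.t e ∧ H.ω (φ e) = G.ω e

/-- The graph without vertices. -/
def empty (α : Type) : WGraph α where
  V := ∅
  E := Empty
  countable_E := inferInstance
  s := Empty.elim
  t := Empty.elim
  s_mem := fun e => e.elim
  t_mem := fun e => e.elim
  ω := Empty.elim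

/-- The graph `Φ` of a map `φ` on a finite set `A` (used when `φ` is a bijection from `A` onto a
set disjoint from `A`): for each `a ∈ A` an edge `a → φ a` (index `true`) and an edge `φ a → a`
(index `false`), all of weight `1`. -/
def fax [DecidableEq α] (A : Finset α) (φ : α → α) : WGraph α where
  V := A ∪ A.image φ
  E := {a // a ∈ A} × Bool
  countable_E := inferInstance
  s := fun e => if e.2 then e.1 else φ e.1
  t := fun e => if e.2 then φ e.1 else e.1
  s_mem := by
    rintro ⟨⟨a, ha⟩, b⟩
    cases b
    · exact Finset.mem_union_right _ (Finset.mem_image_of_mem φ ha)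
    · exact Finset.mem_union_left _ ha
  t_mem := by
    rintro ⟨⟨a, ha⟩, b⟩
    cases b
    · exact Finset.mem_union_left _ ha
    · exact Finset.mem_union_right _ (Finset.mem_image_of_mem φ ha)
  ω := fun _ => ⟨1, one_pos, le_rfl⟩

variable [DecidableEq α]

/-- Union of graphs: union of the vertices, disjoint union of the edges.
The plugging `G □ H` is this graph together with the colouring of its edges by
`Sum.isLeft` (edges of `G`) and `Sum.isRight` (edges of `H`). -/
def union (G H : WGraph α) : WGraph α where
  V := G.V ∪ H.V
  E := G.E ⊕ H.E
  countable_E := by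
    have := G.countable_E
    have := H.countable_E
    infer_instance
  s := Sum.elim G.s H.s
  t := Sum.elim G.t H.t
  s_mem := by
    rintro (e | e)
    · exact Finset.mem_union_left _ (G.s_mem e)
    · exact Finset.mem_union_right _ (H.s_mem e)
  t_mem := by
    rintro (e | e)
    · exact Finset.mem_union_left _ (G.t_mem e)
    · exact Finset.mem_union_right _ (H.t_mem e)
  ω := Sum.elim G.ω H.ω

/-- `f` may follow `e` in an alternating path of the plugging of `G` and `H`:
`f` starts where `e` ends and has the other colour. -/
def AltNext (G H : WGraph α) (e f : G.E ⊕ H.E) : Prop :=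
  (G.union H).t e = (G.union H).s f ∧ e.isLeft ≠ f.isLeft

/-- Edges of the reduction: the (non-empty) alternating paths of the plugging of `G` and `H` that
begin and end in the symmetric difference of the sets of vertices. -/
structure RedPath (G H : WGraph α) where
  edges : List (G.E ⊕ H.E)
  ne_nil : edges ≠ []
  alt : edges.IsChain (AltNext G H)
  src_mem : (G.union H).s (edges.head ne_nil) ∈ symmDiff G.V H.V
  tgt_mem : (G.union H).t (edges.getLast ne_nil) ∈ symmDiff G.V H.V

/-- The reduction `G :: H`. -/
def reduction (G H : WGraph α) : WGraph α where
  V := symmDiff G.V H.V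
  E := RedPath G H
  countable_E := by
    have := G.countable_E
    have := H.countable_E
    have hinj : Function.Injective (RedPath.edges : RedPath G H → List (G.E ⊕ H.E)) := by
      rintro ⟨l, _, _, _, _⟩ ⟨m, _, _, _, _⟩ h
      cases h
      rfl
    exact hinj.countable
  s := fun p => (G.union H).s (p.edges.head p.ne_nil)
  t := fun p => (G.union H).t (p.edges.getLast p.ne_nil)
  s_mem := fun p => p.src_mem
  t_mem := fun p => p.tgt_mem
  ω := fun p => (p.edges.map (G.union H).ω).prod

/-- Alternating cycles of the plugging of `G` and `H`: alternating paths that end where they begin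
and whose last and first edges have different colours. -/
def IsAltCycle (G H : WGraph α) (l : List (G.E ⊕ H.E)) : Prop :=
  l.IsChain (AltNext G H) ∧ ∃ h : l ≠ [], AltNext G H (l.getLast h) (l.head h)

/-- `l` is not a proper power of another list: the only `k` such that `l` is a concatenation of
`k` copies of some list is `k = 1`. -/
def IsPrimitive {E : Type} (l : List E) : Prop :=
  ∀ (m : List E) (k : ℕ), l = (List.replicate k m).flatten → k = 1

/-- The alternating `1`-circuits of the plugging of `G` and `H`: the alternating `1`-cycles,
modulo cyclic permutation. -/
def circuits (G H : WGraph α) : Set (Cycle (G.E ⊕ H.E)) :=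
  {c | ∃ l : List (G.E ⊕ H.E), IsAltCycle G H l ∧ IsPrimitive l ∧ (l : Cycle (G.E ⊕ H.E)) = c}

/-- The weight of a circuit: the product of the weights of its edges. -/
def circuitWeight (G H : WGraph α) (c : Cycle (G.E ⊕ H.E)) : Set.Ioc (0 : ℝ) 1 :=
  (c.toMultiset.map (G.union H).ω).prod

end WGraph

open Classical in
/-- `-log (1 - x)` for `x ∈ ]0,1]`, with value `∞` at `x = 1`. -/
noncomputable def colog (x : Set.Ioc (0 : ℝ) 1) : ENNReal :=
  if (x : ℝ) = 1 then ⊤ else ENNReal.ofReal (-Real.log (1 - (x : ℝ)))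

/-- The interaction `⟨G, H⟩ ∈ [0, ∞]`: the sum of `-log (1 - ω(c))` over all alternating
`1`-circuits `c`. -/
noncomputable def WGraph.interaction {α : Type} [DecidableEq α] (G H : WGraph α) : ENNReal :=
  ∑' c : WGraph.circuits G H, colog (WGraph.circuitWeight G H c)

/-- Graphs without common vertices do not interact. -/
theorem WGraph.interaction_eq_zero {α : Type} [DecidableEq α] (G H : WGraph α)
    (h : Disjoint G.V H.V) : G.interaction H = 0 := by
  have key : ∀ e f, ¬ WGraph.AltNext G H e f := by
    rintro (e | e) (f | f) ⟨h1, h2⟩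
    · exact h2 rfl
    · have h1' : G.t e = H.s f := h1
      exact Finset.disjoint_left.mp h (G.t_mem e) (h1' ▸ H.s_mem f)
    · have h1' : H.t e = G.s f := h1
      exact Finset.disjoint_left.mp h (G.s_mem f) (h1' ▸ H.t_mem e)
    · exact h2 rfl
  have : IsEmpty (WGraph.circuits G H) := by
    refine ⟨?_⟩
    rintro ⟨c, l, ⟨-, hl, hn⟩, -⟩
    exact key _ _ hn
  unfold WGraph.interaction
  exact tsum_empty

/-! ### Projects, orthogonality and conducts -/

/-- A project: a wager in `[0, ∞[` and a graph, whose set of vertices is the carrier. -/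
structure Project (α : Type) where
  wager : NNReal
  graph : WGraph α

namespace Project

variable {α : Type}

/-- Equality of projects: same wager and same graph (up to the names of the edges). -/
def Same (a b : Project α) : Prop :=
  a.wager = b.wager ∧ a.graph.Same b.graph

variable [DecidableEq α]

/-- The measurement of the interaction of two projects, in `[0, ∞]`. -/
noncomputable def meas (a b : Project α) : ENNReal :=
  (a.wager : ENNReal) + (b.wager : ENNReal) + a.graph.interaction b.graph

/-- The measurement of projects with disjoint carriers is the sum of the wagers. -/
theorem meas_of_disjoint (a b : Project α) (h : Disjoint a.graph.V b.graph.V) :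
    a.meas b = ((a.wager + b.wager : NNReal) : ENNReal) := by
  simp [meas, WGraph.interaction_eq_zero _ _ h]

/-- The tensor product, defined for projects with disjoint carriers; its wager is
`meas a b = a.wager + b.wager`. -/
def tensor (a b : Project α) : Option (Project α) :=
  if Disjoint a.graph.V b.graph.V then some ⟨a.wager + b.wager, a.graph.union b.graph⟩ else none

open Classical in
/-- The cut of two projects, defined when their measurement is finite. -/
noncomputable def cut (a b : Project α) : Option (Project α) :=
  if a.meas b = ⊤ then none else some ⟨(a.meas b).toNNReal, a.graph.reduction b.graph⟩

/-- Orthogonality of projects of the same carrier. -/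
def Orthogonal (a b : Project α) : Prop :=
  a.meas b ≠ 0 ∧ a.meas b ≠ ⊤

/-- The orthogonal of a set of projects of carrier `X`. -/
def orthogonal (X : Finset α) (S : Set (Project α)) : Set (Project α) :=
  {b | b.graph.V = X ∧ ∀ a ∈ S, a.Orthogonal b}

end Project

/-- A conduct of carrier `X`: a non-empty set of projects of carrier `X` equal to its
biorthogonal. -/
structure Conduct {α : Type} [DecidableEq α] (X : Finset α) where
  projects : Set (Project α)
  nonempty : projects.Nonempty
  biorthogonal : Project.orthogonal X (Project.orthogonal X projects) = projects

/-- A basis of interpretation for the sizes `n`: a conduct of carrier `{0, …, n i - 1}` for each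
variable name `X_i`. -/
def Basis (n : ℕ → ℕ) : Type 1 :=
  ∀ i, Conduct (Finset.range (n i))

/-! ### Formulas, sequents and proofs of locMLL -/

/-- Formulas over the localized variables `X_i(j)` (`var i j`) and their negations
(`nvar i j`). Disjointness of locations is imposed by `Formula.IsLocated`. -/
inductive Formula : Type
  | var (i j : ℕ)
  | nvar (i j : ℕ)
  | tensor (A B : Formula)
  | par (A B : Formula)
  | one
  | bot

namespace Formula

/-- Linear negation, pushed to the atoms by the De Morgan laws. -/
def dual : Formula → Formula
  | var i j => nvar i j
  | nvar i j => var i j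
  | tensor A B => par A.dual B.dual
  | par A B => tensor A.dual B.dual
  | one => bot
  | bot => one

end Formula

/-- The location `{(i, m) | j n_i ≤ m < (j + 1) n_i}` of the variable `X_i(j)`. -/
def varLoc (n : ℕ → ℕ) (i j : ℕ) : Finset (ℕ × ℕ) :=
  {i} ×ˢ Finset.Ico (j * n i) ((j + 1) * n i)

namespace Formula

/-- The location of a formula. -/
def loc (n : ℕ → ℕ) : Formula → Finset (ℕ × ℕ)
  | var i j => varLoc n i j
  | nvar i j => varLoc n i j
  | tensor A B => A.loc n ∪ B.loc n
  | par A B => A.loc n ∪ B.loc n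
  | one => ∅
  | bot => ∅

/-- The formulas of locMLL: the two sides of a connective have disjoint locations. -/
def IsLocated (n : ℕ → ℕ) : Formula → Prop
  | var _ _ => True
  | nvar _ _ => True
  | tensor A B => A.IsLocated n ∧ B.IsLocated n ∧ Disjoint (A.loc n) (B.loc n)
  | par A B => A.IsLocated n ∧ B.IsLocated n ∧ Disjoint (A.loc n) (B.loc n)
  | one => True
  | bot => True

end Formula

/-- The location of a sequent: the union of the locations of its formulas. -/
def seqLoc (n : ℕ → ℕ) (Γ : Multiset Formula) : Finset (ℕ × ℕ) :=
  (Γ.map (Formula.loc n)).sup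

/-- The sequents of locMLL: multisets of formulas of locMLL with pairwise disjoint locations. -/
def IsSequent (n : ℕ → ℕ) (Γ : Multiset Formula) : Prop :=
  (∀ A ∈ Γ, A.IsLocated n) ∧ Γ.Pairwise fun A B => Disjoint (A.loc n) (B.loc n)

/-- Derivation trees, with the rules of locMLL as nodes:
`ax i j k` introduces `⊢ X_i(j)^⊥, X_i(k)`; `cut A` cuts `A` in the first premise against the dual
of `A` in the second; `tensor A B` and `par A B` introduce `A ⊗ B` and `A ⅋ B`. -/
inductive Tree : Type
  | ax (i j k : ℕ)
  | cut (A : Formula) (π ρ : Tree)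
  | tensor (A B : Formula) (π ρ : Tree)
  | par (A B : Formula) (π : Tree)
  | one
  | bot (π : Tree)
  | mix (π ρ : Tree)

/-- `Derives n π Γ`: the tree `π` is a correct derivation of `⊢ Γ` in the localized sequent
calculus. -/
inductive Derives (n : ℕ → ℕ) : Tree → Multiset Formula → Prop
  | ax (i j k : ℕ) (hjk : j ≠ k) :
      Derives n (Tree.ax i j k) {Formula.nvar i j, Formula.var i k}
  | cut (A : Formula) (Δ Γ : Multiset Formula) (π ρ : Tree)
      (hπ : Derives n π (A ::ₘ Δ)) (hρ : Derives n ρ (A.dual ::ₘ Γ))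
      (hloc : Disjoint (seqLoc n Δ) (seqLoc n Γ)) :
      Derives n (Tree.cut A π ρ) (Δ + Γ)
  | tensor (A B : Formula) (Δ Γ : Multiset Formula) (π ρ : Tree)
      (hπ : Derives n π (A ::ₘ Δ)) (hρ : Derives n ρ (B ::ₘ Γ))
      (hloc : Disjoint (seqLoc n (A ::ₘ Δ)) (seqLoc n (B ::ₘ Γ))) :
      Derives n (Tree.tensor A B π ρ) (Formula.tensor A B ::ₘ (Δ + Γ))
  | par (A B : Formula) (Γ : Multiset Formula) (π : Tree)
      (hπ : Derives n π (A ::ₘ B ::ₘ Γ)) :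
      Derives n (Tree.par A B π) (Formula.par A B ::ₘ Γ)
  | one : Derives n Tree.one {Formula.one}
  | bot (Γ : Multiset Formula) (π : Tree) (hπ : Derives n π Γ) :
      Derives n (Tree.bot π) (Formula.bot ::ₘ Γ)
  | mix (Γ Δ : Multiset Formula) (π ρ : Tree)
      (hπ : Derives n π Γ) (hρ : Derives n ρ Δ)
      (hloc : Disjoint (seqLoc n Γ) (seqLoc n Δ)) :
      Derives n (Tree.mix π ρ) (Γ + Δ)

theorem seqLoc_cons (n : ℕ → ℕ) (A : Formula) (Γ : Multiset Formula) :
    seqLoc n (A ::ₘ Γ) = A.loc n ∪ seqLoc n Γ := by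
  simp [seqLoc]

theorem seqLoc_add (n : ℕ → ℕ) (Γ Δ : Multiset Formula) :
    seqLoc n (Γ + Δ) = seqLoc n Γ ∪ seqLoc n Δ := by
  simp [seqLoc]

theorem isSequent_zero (n : ℕ → ℕ) : IsSequent n 0 :=
  ⟨by simp, [], rfl, List.Pairwise.nil⟩

theorem isSequent_cons {n : ℕ → ℕ} {A : Formula} {Γ : Multiset Formula} :
    IsSequent n (A ::ₘ Γ) ↔ A.IsLocated n ∧ Disjoint (A.loc n) (seqLoc n Γ) ∧ IsSequent n Γ := by
  have hs : Std.Symm fun A B : Formula => Disjoint (A.loc n) (B.loc n) := ⟨fun _ _ h => h.symm⟩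
  have hd : Disjoint (A.loc n) (seqLoc n Γ) ↔ ∀ B ∈ Γ, Disjoint (A.loc n) (B.loc n) := by
    induction Γ using Multiset.induction_on with
    | empty => simp [seqLoc]
    | cons B Γ ih => simp [seqLoc_cons, Finset.disjoint_union_right, ih]
  rw [hd]
  induction Γ using Quotient.inductionOn with
  | h l =>
    change IsSequent n ((A :: l : List Formula) : Multiset Formula) ↔
      _ ∧ (∀ B ∈ (l : Multiset Formula), _) ∧ IsSequent n (l : Multiset Formula)
    simp only [IsSequent, Multiset.pairwise_coe_iff_pairwise, List.pairwise_cons,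
      Multiset.mem_coe, List.mem_cons, forall_eq_or_imp]
    tauto

theorem isSequent_add {n : ℕ → ℕ} {Γ Δ : Multiset Formula} :
    IsSequent n (Γ + Δ) ↔
      IsSequent n Γ ∧ IsSequent n Δ ∧ Disjoint (seqLoc n Γ) (seqLoc n Δ) := by
  induction Γ using Multiset.induction_on with
  | empty => simp [isSequent_zero, seqLoc]
  | cons A Γ ih =>
    rw [Multiset.cons_add, isSequent_cons, isSequent_cons, ih, seqLoc_add, seqLoc_cons,
      Finset.disjoint_union_right, Finset.disjoint_union_left]
    tauto

theorem varLoc_disjoint (n : ℕ → ℕ) (i j k : ℕ) (h : j ≠ k) :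
    Disjoint (varLoc n i j) (varLoc n i k) := by
  refine Finset.disjoint_left.mpr ?_
  rintro ⟨a, m⟩ h1 h2
  simp only [varLoc, Finset.mem_product, Finset.mem_Ico] at h1 h2
  rcases Nat.lt_or_gt_of_ne h with hl | hl
  · have := Nat.mul_le_mul_right (n i) (Nat.succ_le_of_lt hl)
    have := h1.2.2
    have := h2.2.1
    simp only [Nat.succ_eq_add_one] at *
    omega
  · have := Nat.mul_le_mul_right (n i) (Nat.succ_le_of_lt hl)
    have := h1.2.1
    have := h2.2.2
    simp only [Nat.succ_eq_add_one] at *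
    omega

/-- The side conditions of the rules guarantee that every derived sequent is one of locMLL. -/
theorem Derives.isSequent {n : ℕ → ℕ} {π : Tree} {Γ : Multiset Formula} (h : Derives n π Γ) :
    IsSequent n Γ := by
  induction h with
  | ax i j k hjk =>
    have : ({Formula.nvar i j, Formula.var i k} : Multiset Formula) =
        Formula.nvar i j ::ₘ Formula.var i k ::ₘ 0 := rfl
    rw [this, isSequent_cons, isSequent_cons]
    simp [Formula.IsLocated, Formula.loc, seqLoc, isSequent_zero, varLoc_disjoint n i j k hjk]
  | cut A Δ Γ π ρ _ _ hloc ih1 ih2 =>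
    rw [isSequent_cons] at ih1 ih2
    exact isSequent_add.mpr ⟨ih1.2.2, ih2.2.2, hloc⟩
  | tensor A B Δ Γ π ρ _ _ hloc ih1 ih2 =>
    rw [isSequent_cons] at ih1 ih2
    rw [isSequent_cons, isSequent_add]
    simp only [seqLoc_cons, seqLoc_add, Finset.disjoint_union_left, Finset.disjoint_union_right,
      Formula.IsLocated, Formula.loc] at *
    have := hloc.1.2.symm
    have := hloc.2.1.symm
    tauto
  | par A B Γ π _ ih =>
    rw [isSequent_cons, isSequent_cons] at ih
    rw [isSequent_cons]
    simp only [seqLoc_cons, Finset.disjoint_union_left, Finset.disjoint_union_right,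
      Formula.IsLocated, Formula.loc] at *
    tauto
  | one =>
    have : ({Formula.one} : Multiset Formula) = Formula.one ::ₘ 0 := rfl
    rw [this, isSequent_cons]
    simp [Formula.IsLocated, Formula.loc, isSequent_zero]
  | bot Γ π _ ih =>
    rw [isSequent_cons]
    simp [Formula.IsLocated, Formula.loc, ih]
  | mix Γ Δ π ρ _ _ hloc ih1 ih2 => exact isSequent_add.mpr ⟨ih1, ih2, hloc⟩

namespace Tree

/-- The variables `X_i(j)` introduced by the axiom rules of a tree, as pairs `(i, j)`, with
multiplicity. -/
def axVars : Tree → Multiset (ℕ × ℕ)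
  | ax i _ k => {(i, k)}
  | cut _ π ρ => π.axVars + ρ.axVars
  | tensor _ _ π ρ => π.axVars + ρ.axVars
  | par _ _ π => π.axVars
  | one => 0
  | bot π => π.axVars
  | mix π ρ => π.axVars + ρ.axVars

/-- The negated variables `X_i(j)^⊥` introduced by the axiom rules of a tree, as pairs `(i, j)`,
with multiplicity. -/
def axNVars : Tree → Multiset (ℕ × ℕ)
  | ax i j _ => {(i, j)}
  | cut _ π ρ => π.axNVars + ρ.axNVars
  | tensor _ _ π ρ => π.axNVars + ρ.axNVars
  | par _ _ π => π.axNVars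
  | one => 0
  | bot π => π.axNVars
  | mix π ρ => π.axNVars + ρ.axNVars

/-- The tree contains no cut rule. -/
def CutFree : Tree → Prop
  | ax _ _ _ => True
  | cut _ _ _ => False
  | tensor _ _ π ρ => π.CutFree ∧ ρ.CutFree
  | par _ _ π => π.CutFree
  | one => True
  | bot π => π.CutFree
  | mix π ρ => π.CutFree ∧ ρ.CutFree

end Tree

/-- `π` is a proof of `⊢ Γ` in locMLL: a correct derivation in which every variable and every
negated variable appears in at most one axiom rule. -/
def IsProof (n : ℕ → ℕ) (π : Tree) (Γ : Multiset Formula) : Prop :=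
  Derives n π Γ ∧ π.axVars.Nodup ∧ π.axNVars.Nodup

/-! ### Cut elimination -/

/-- `CutStep n A π ρ τ`: the cut of `π ⊢ A, Δ` against `ρ ⊢ A^⊥, Γ` is replaced by `τ`.
The first three are the key steps. In the commutation steps the last rule of `π` does not
introduce the cut occurrence of `A`, which thus occurs among the side formulas of a premise;
the cut is moved to that premise. -/
inductive CutStep (n : ℕ → ℕ) : Formula → Tree → Tree → Tree → Prop
  | ax_ax (i j k l : ℕ) (hjl : j ≠ l) :
      CutStep n (Formula.var i k) (Tree.ax i j k) (Tree.ax i k l) (Tree.ax i j l)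
  | tensor_par (A B : Formula) (π₁ π₂ π₃ : Tree) :
      CutStep n (Formula.tensor A B) (Tree.tensor A B π₁ π₂) (Tree.par A.dual B.dual π₃)
        (Tree.cut B π₂ (Tree.cut A π₁ π₃))
  | one_bot (π : Tree) :
      CutStep n Formula.one Tree.one (Tree.bot π) π
  | comm_par (A B C : Formula) (Δ : Multiset Formula) (π ρ : Tree)
      (hA : Derives n π (B ::ₘ C ::ₘ A ::ₘ Δ)) :
      CutStep n A (Tree.par B C π) ρ (Tree.par B C (Tree.cut A π ρ))
  | comm_tensor_left (A B C : Formula) (Δ : Multiset Formula) (π₁ π₂ ρ : Tree)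
      (hA : Derives n π₁ (B ::ₘ A ::ₘ Δ)) :
      CutStep n A (Tree.tensor B C π₁ π₂) ρ (Tree.tensor B C (Tree.cut A π₁ ρ) π₂)
  | comm_tensor_right (A B C : Formula) (Δ : Multiset Formula) (π₁ π₂ ρ : Tree)
      (hA : Derives n π₂ (C ::ₘ A ::ₘ Δ)) :
      CutStep n A (Tree.tensor B C π₁ π₂) ρ (Tree.tensor B C π₁ (Tree.cut A π₂ ρ))
  | comm_bot (A : Formula) (Δ : Multiset Formula) (π ρ : Tree)
      (hA : Derives n π (A ::ₘ Δ)) :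
      CutStep n A (Tree.bot π) ρ (Tree.bot (Tree.cut A π ρ))
  | comm_mix_left (A : Formula) (Δ : Multiset Formula) (π₁ π₂ ρ : Tree)
      (hA : Derives n π₁ (A ::ₘ Δ)) :
      CutStep n A (Tree.mix π₁ π₂) ρ (Tree.mix (Tree.cut A π₁ ρ) π₂)
  | comm_mix_right (A : Formula) (Δ : Multiset Formula) (π₁ π₂ ρ : Tree)
      (hA : Derives n π₂ (A ::ₘ Δ)) :
      CutStep n A (Tree.mix π₁ π₂) ρ (Tree.mix π₁ (Tree.cut A π₂ ρ))
  | comm_cut_left (A B : Formula) (Δ : Multiset Formula) (π₁ π₂ ρ : Tree)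
      (hA : Derives n π₁ (B ::ₘ A ::ₘ Δ)) :
      CutStep n A (Tree.cut B π₁ π₂) ρ (Tree.cut B (Tree.cut A π₁ ρ) π₂)
  | comm_cut_right (A B : Formula) (Δ : Multiset Formula) (π₁ π₂ ρ : Tree)
      (hA : Derives n π₂ (B.dual ::ₘ A ::ₘ Δ)) :
      CutStep n A (Tree.cut B π₁ π₂) ρ (Tree.cut B π₁ (Tree.cut A π₂ ρ))

/-- One step of cut elimination, anywhere in a tree. A cut may be acted upon with its two premises
read in either order. -/
inductive Step (n : ℕ → ℕ) : Tree → Tree → Prop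
  | cut (A : Formula) (π ρ τ : Tree) (h : CutStep n A π ρ τ) : Step n (Tree.cut A π ρ) τ
  | cut_symm (A : Formula) (π ρ τ : Tree) (h : CutStep n A.dual ρ π τ) :
      Step n (Tree.cut A π ρ) τ
  | in_cut_left (A : Formula) (π τ ρ : Tree) (h : Step n π τ) :
      Step n (Tree.cut A π ρ) (Tree.cut A τ ρ)
  | in_cut_right (A : Formula) (π ρ τ : Tree) (h : Step n ρ τ) :
      Step n (Tree.cut A π ρ) (Tree.cut A π τ)
  | in_tensor_left (A B : Formula) (π τ ρ : Tree) (h : Step n π τ) :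
      Step n (Tree.tensor A B π ρ) (Tree.tensor A B τ ρ)
  | in_tensor_right (A B : Formula) (π ρ τ : Tree) (h : Step n ρ τ) :
      Step n (Tree.tensor A B π ρ) (Tree.tensor A B π τ)
  | in_par (A B : Formula) (π τ : Tree) (h : Step n π τ) :
      Step n (Tree.par A B π) (Tree.par A B τ)
  | in_bot (π τ : Tree) (h : Step n π τ) : Step n (Tree.bot π) (Tree.bot τ)
  | in_mix_left (π τ ρ : Tree) (h : Step n π τ) : Step n (Tree.mix π ρ) (Tree.mix τ ρ)
  | in_mix_right (π ρ τ : Tree) (h : Step n ρ τ) : Step n (Tree.mix π ρ) (Tree.mix π τ)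

/-- `Reduces n π τ`: `τ` is obtained from `π` by finitely many steps of cut elimination. -/
def Reduces (n : ℕ → ℕ) : Tree → Tree → Prop :=
  Relation.ReflTransGen (Step n)

/-! ### Interpretation of proofs -/

/-- The `Fax` of the axiom `⊢ X_i(j)^⊥, X_i(k)`: wager `0` and the graph of the bijection
`(i, j n_i + x) ↦ (i, k n_i + x)`, `0 ≤ x < n_i`. -/
def axFax (n : ℕ → ℕ) (i j k : ℕ) : Project (ℕ × ℕ) :=
  ⟨0, WGraph.fax (varLoc n i j) fun p => (i, k * n i + (p.2 - j * n i))⟩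

/-- The interpretation `I_Φ(π)` of a proof along a basis of interpretation `Φ`; it is `none` if
some tensor product or some cut of projects on the way is not defined. (The clauses depend on `Φ`
through the sizes `n` only.) -/
noncomputable def interp {n : ℕ → ℕ} (Φ : Basis n) : Tree → Option (Project (ℕ × ℕ))
  | Tree.ax i j k => some (axFax n i j k)
  | Tree.cut _ π ρ => (interp Φ π).bind fun a => (interp Φ ρ).bind fun b => a.cut b
  | Tree.tensor _ _ π ρ => (interp Φ π).bind fun a => (interp Φ ρ).bind fun b => a.tensor b
  | Tree.par _ _ π => interp Φ π
  | Tree.one => some ⟨0, WGraph.empty (ℕ × ℕ)⟩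
  | Tree.bot π => interp Φ π
  | Tree.mix π ρ => (interp Φ π).bind fun a => (interp Φ ρ).bind fun b => a.tensor b

end LocMLL

namespace LocMLL

open Relation

/-! ### Denotations: located relations and their composition along alternating paths -/

/-! The graphs met in the interpretation of a proof are very special: all weights are 1 and at most
one edge leaves each vertex. Such a graph is determined, up to renaming of edges, by its carrier and
its edge relation (`WGraph.Denotes.same`). If no cut creates an alternating cycle, all interactions
are empty sums, the wagers stay 0, and a project can be replaced by a relation on a finite set, a
`Den`: tensor becomes union, and cut becomes composition along alternating paths, left undefined in
the presence of an alternating cycle. `interp_denotes` transfers results from `den` back to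
`interp`.

The calculation rests on one associativity law, `Den.cut_union`: for disjoint `d₁` and `d₂`, cutting
their union against `d₃` amounts to cutting `d₁` against `d₃` and then `d₂` against the result, the
two sides being undefined together. This is the tensor/par step. Since a cut of disjoint relations
is a union (`Den.cut_of_disjoint`), it gives the commutations with tensor and mix; since union is
commutative, it gives the commutation of two cuts. The axiom step is `Den.cut_link` and the unit
step is `Den.empty_cut`. The disjointness needed comes from the locations of the sequents, except
when two cuts are commuted: there it comes from each atom being introduced by at most one axiom
(`disjoint_loc_of_linear`).

Hence every step preserves the `Option`-valued denotation of a proof. Definedness then flows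
backwards: a cut-free tree has a denotation because only cut is partial, so the original proof has
the same one. Acyclicity of the cuts in an arbitrary proof never has to be proved directly.

Existence of a cut-free reduct is the usual double induction, on the size of the cut formula and
then on the sizes of the cut-free premises (`exists_reduces_cut`). Positive sizes serve only to
exclude a cut between two axioms that would produce an axiom linking an atom to its own negation
(`ax_ne_of_cut`). -/

/-- A relation on a finite set of locations. -/
@[ext]
structure Den (α : Type) where
  V : Finset α
  R : α → α → Prop
  left_mem : ∀ {x y}, R x y → x ∈ V
  right_mem : ∀ {x y}, R x y → y ∈ V

/-- The alternating steps between `P` (used from the states of colour `false`) and `Q` (used from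
the states of colour `true`). -/
def AltStep {α : Type} (P Q : α → α → Prop) (p q : α × Bool) : Prop :=
  q.2 = !p.2 ∧ if p.2 then Q p.1 q.1 else P p.1 q.1

section AltStep

variable {α : Type} {P Q : α → α → Prop}

@[simp]
theorem altStep_false {x y : α} {c : Bool} :
    AltStep P Q (x, false) (y, c) ↔ c = true ∧ P x y := by
  simp [AltStep]

@[simp]
theorem altStep_true {x y : α} {c : Bool} :
    AltStep P Q (x, true) (y, c) ↔ c = false ∧ Q x y := by
  simp [AltStep]

theorem AltStep.swap {p q : α × Bool} (h : AltStep P Q p q) :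
    AltStep Q P (p.1, !p.2) (q.1, !q.2) := by
  obtain ⟨x, c⟩ := p
  obtain ⟨y, d⟩ := q
  cases c <;> simp_all

theorem altStep_transGen_swap {p q : α × Bool} (h : TransGen (AltStep P Q) p q) :
    TransGen (AltStep Q P) (p.1, !p.2) (q.1, !q.2) :=
  TransGen.lift (fun p : α × Bool => (p.1, !p.2)) (fun _ _ => AltStep.swap) _ _ h

end AltStep

namespace Den

variable {α : Type}

/-- The relation without locations. -/
def empty (α : Type) : Den α where
  V := ∅
  R _ _ := False
  left_mem h := h.elim
  right_mem h := h.elim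

variable [DecidableEq α]

/-- The union of two located relations. -/
def union (d e : Den α) : Den α where
  V := d.V ∪ e.V
  R x y := d.R x y ∨ e.R x y
  left_mem h := Finset.mem_union.mpr (h.imp d.left_mem e.left_mem)
  right_mem h := Finset.mem_union.mpr (h.imp d.right_mem e.right_mem)

/-- The composition of two located relations along alternating paths. -/
def comp (d e : Den α) : Den α where
  V := symmDiff d.V e.V
  R x y := x ∈ symmDiff d.V e.V ∧ y ∈ symmDiff d.V e.V ∧
    ∃ c c', TransGen (AltStep d.R e.R) (x, c) (y, c')
  left_mem h := h.1
  right_mem h := h.2.1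

/-- There is no alternating cycle. -/
def Acyclic (d e : Den α) : Prop :=
  ∀ p, ¬ TransGen (AltStep d.R e.R) p p

open Classical in
/-- The composition, defined in the absence of alternating cycles. -/
noncomputable def cut (d e : Den α) : Option (Den α) :=
  if d.Acyclic e then some (d.comp e) else none

omit [DecidableEq α] in
theorem Acyclic.symm {d e : Den α} (h : d.Acyclic e) : e.Acyclic d :=
  fun _ hp => h _ (altStep_transGen_swap hp)

theorem comp_comm (d e : Den α) : d.comp e = e.comp d := by
  have key : ∀ (d e : Den α) x y, (d.comp e).R x y → (e.comp d).R x y := by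
    rintro d e x y ⟨hx, hy, c, c', h⟩
    exact ⟨symmDiff_comm d.V e.V ▸ hx, symmDiff_comm d.V e.V ▸ hy, _, _, altStep_transGen_swap h⟩
  ext x y
  · simp [comp, symmDiff_comm]
  · exact ⟨key _ _ _ _, key _ _ _ _⟩

theorem cut_comm (d e : Den α) : d.cut e = e.cut d := by
  have : d.Acyclic e ↔ e.Acyclic d := ⟨Acyclic.symm, Acyclic.symm⟩
  by_cases h : d.Acyclic e
  · simp [cut, h, this.mp h, comp_comm d e]
  · simp [cut, h, mt this.mpr h]

theorem union_comm (d e : Den α) : d.union e = e.union d := by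
  ext x y
  · simp [union, or_comm]
  · exact or_comm

@[simp]
theorem empty_union (d : Den α) : (empty α).union d = d := by
  ext x y
  · simp [union, empty]
  · simp [union, empty]

/-! ### Disjoint carriers: composition is union. -/

section Disjoint

variable {d e : Den α}

omit [DecidableEq α] in
-- The middle location of two consecutive steps lies in both carriers, so over disjoint carriers
-- alternating paths have length one.
theorem altStep_not_comp (h : Disjoint d.V e.V) {p q r : α × Bool}
    (h1 : AltStep d.R e.R p q) (h2 : AltStep d.R e.R q r) : False := by
  obtain ⟨x, c⟩ := p
  obtain ⟨y, c'⟩ := q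
  obtain ⟨z, c''⟩ := r
  cases c
  · rw [altStep_false] at h1
    obtain ⟨rfl, h1⟩ := h1
    rw [altStep_true] at h2
    obtain ⟨rfl, h2⟩ := h2
    exact Finset.disjoint_left.mp h (d.right_mem h1) (e.left_mem h2)
  · rw [altStep_true] at h1
    obtain ⟨rfl, h1⟩ := h1
    rw [altStep_false] at h2
    obtain ⟨rfl, h2⟩ := h2
    exact Finset.disjoint_left.mp h (d.left_mem h2) (e.right_mem h1)

omit [DecidableEq α] in
theorem transGen_of_disjoint (h : Disjoint d.V e.V) {p q : α × Bool}
    (hpq : TransGen (AltStep d.R e.R) p q) : AltStep d.R e.R p q := by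
  induction hpq with
  | single h => exact h
  | tail _ h2 ih => exact (altStep_not_comp h ih h2).elim

theorem cut_of_disjoint (h : Disjoint d.V e.V) : d.cut e = some (d.union e) := by
  have hac : d.Acyclic e := fun p hp => by
    have := transGen_of_disjoint h hp
    exact altStep_not_comp h this this
  rw [cut, if_pos hac]
  have hV : symmDiff d.V e.V = d.V ∪ e.V := h.symmDiff_eq_sup
  congr 1
  ext x y
  · simp [comp, union, hV]
  · simp only [comp, union, hV]
    constructor
    · rintro ⟨-, -, c, c', hp⟩
      have := transGen_of_disjoint h hp
      cases c <;> simp_all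
    · intro hxy
      refine ⟨(d.union e).left_mem hxy, (d.union e).right_mem hxy, ?_⟩
      rcases hxy with hxy | hxy
      · exact ⟨false, true, .single (by simpa using hxy)⟩
      · exact ⟨true, false, .single (by simpa using hxy)⟩

end Disjoint

/-! ### Associativity of composition along alternating paths. -/

section Assoc

variable {d₁ d₂ d₃ : Den α}

omit [DecidableEq α] in
theorem altStep_left_mem {d e : Den α} {x : α} {c : Bool} {q : α × Bool}
    (h : TransGen (AltStep d.R e.R) (x, c) q) : if c then x ∈ e.V else x ∈ d.V := by
  obtain ⟨⟨y, c'⟩, h, -⟩ := TransGen.head'_iff.mp h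
  cases c
  · exact d.left_mem (altStep_false.mp h).2
  · exact e.left_mem (altStep_true.mp h).2

omit [DecidableEq α] in
theorem altStep_right_mem {d e : Den α} {y : α} {c : Bool} {p : α × Bool}
    (h : TransGen (AltStep d.R e.R) p (y, c)) : if c then y ∈ d.V else y ∈ e.V := by
  obtain ⟨⟨x, c'⟩, -, h'⟩ := TransGen.tail'_iff.mp h
  cases c'
  · rw [altStep_false] at h'
    obtain ⟨rfl, h'⟩ := h'
    exact d.right_mem h'
  · rw [altStep_true] at h'
    obtain ⟨rfl, h'⟩ := h'
    exact e.right_mem h'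

theorem altStep_union_mono {p q : α × Bool} (h : AltStep d₁.R d₃.R p q) :
    AltStep (d₁.union d₂).R d₃.R p q := by
  obtain ⟨x, c⟩ := p
  obtain ⟨y, c'⟩ := q
  cases c
  · rw [altStep_false] at h
    obtain ⟨rfl, h⟩ := h
    simp [union, h]
  · rw [altStep_true] at h
    obtain ⟨rfl, h⟩ := h
    simp [h]

theorem altStep_union_cases {p q : α × Bool} (h : AltStep (d₁.union d₂).R d₃.R p q) :
    AltStep d₁.R d₃.R p q ∨ p.2 = false ∧ q.2 = true ∧ d₂.R p.1 q.1 := by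
  obtain ⟨x, c⟩ := p
  obtain ⟨y, c'⟩ := q
  cases c
  · rw [altStep_false] at h
    obtain ⟨rfl, h⟩ := h
    simpa [union] using h
  · left
    simpa using h

/-- A path between states of colours `true` and `false` at locations of `d₂` composes to an edge
of `d₁.comp d₃`. -/
theorem comp_of_reflTransGen (h12 : Disjoint d₁.V d₂.V) {x y : α}
    (h : ReflTransGen (AltStep d₁.R d₃.R) (x, true) (y, false)) (hx : x ∈ d₂.V) (hy : y ∈ d₂.V) :
    (d₁.comp d₃).R x y := by
  have h' : TransGen (AltStep d₁.R d₃.R) (x, true) (y, false) := by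
    rcases reflTransGen_iff_eq_or_transGen.mp h with h | h
    · simp at h
    · exact h
  have h1 := altStep_left_mem h'
  have h2 := altStep_right_mem h'
  simp only [if_true, Bool.false_eq_true, if_false] at h1 h2
  have := Finset.disjoint_right.mp h12
  refine ⟨?_, ?_, _, _, h'⟩ <;> simp_all [Finset.mem_symmDiff]

/-- Cut the path at its uses of `d₂`: between two of them it runs in `d₁` and `d₃` only and makes a
single edge of `d₁.comp d₃`. The stretch after the last use is kept apart, since it may stop
anywhere. -/
theorem path_decomp (h12 : Disjoint d₁.V d₂.V) {x : α} {q : α × Bool} (hx : x ∈ d₂.V)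
    (h : ReflTransGen (AltStep (d₁.union d₂).R d₃.R) (x, true) q) :
    ∃ z ∈ d₂.V, ReflTransGen (AltStep d₂.R (d₁.comp d₃).R) (x, true) (z, true) ∧
      ReflTransGen (AltStep d₁.R d₃.R) (z, true) q := by
  induction h with
  | refl => exact ⟨x, hx, .refl, .refl⟩
  | @tail p q _ hpq ih =>
    obtain ⟨z, hz, h1, h2⟩ := ih
    -- A step of `d₁` or `d₃` prolongs the open last stretch; a step of `d₂` closes it into a
    -- composite edge and starts an empty one.
    rcases altStep_union_cases hpq with h | ⟨hp, hq, h⟩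
    · exact ⟨z, hz, h1, h2.tail h⟩
    · obtain ⟨y, c⟩ := p
      obtain ⟨y', c'⟩ := q
      simp only at hp hq h
      subst hp hq
      have := comp_of_reflTransGen h12 h2 hz (d₂.left_mem h)
      refine ⟨y', d₂.right_mem h, ?_, .refl⟩
      exact (h1.tail (altStep_true.mpr ⟨rfl, this⟩)).tail (altStep_false.mpr ⟨rfl, h⟩)

/-- Isolates the first use of `d₂`, if there is one. What follows starts in `d₂.V` with colour
`true`, as `path_decomp` requires. -/
theorem path_split {p q : α × Bool} (h : TransGen (AltStep (d₁.union d₂).R d₃.R) p q) :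
    TransGen (AltStep d₁.R d₃.R) p q ∨ ∃ y y', ReflTransGen (AltStep d₁.R d₃.R) p (y, false) ∧
      d₂.R y y' ∧ ReflTransGen (AltStep (d₁.union d₂).R d₃.R) (y', true) q := by
  have aux : ∀ {p q}, AltStep (d₁.union d₂).R d₃.R p q →
      AltStep d₁.R d₃.R p q ∨ ∃ y y', p = (y, false) ∧ q = (y', true) ∧ d₂.R y y' := by
    rintro ⟨x, c⟩ ⟨y, c'⟩ h
    refine (altStep_union_cases h).imp_right ?_
    rintro ⟨h1, h2, h3⟩
    exact ⟨x, y, by simp_all, by simp_all, h3⟩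
  induction h with
  | single h =>
    rcases aux h with h | ⟨y, y', rfl, rfl, h'⟩
    · exact .inl (.single h)
    · exact .inr ⟨y, y', .refl, h', .refl⟩
  | tail _ h ih =>
    rcases ih with ih | ⟨y, y', h1, h2, h3⟩
    · rcases aux h with h | ⟨y, y', rfl, rfl, h'⟩
      · exact .inl (ih.tail h)
      · exact .inr ⟨y, y', ih.to_reflTransGen, h', .refl⟩
    · exact .inr ⟨y, y', h1, h2, h3.tail h⟩

/-- Each composite edge is replaced by a path that it stands for. Such an edge forgets the colours
at its ends, but at a location of `d₂` they are forced, because `d₁` does not meet `d₂`; consecutive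
pieces are glued exactly at such locations. -/
theorem path_expand (h12 : Disjoint d₁.V d₂.V) {u v : α} {c c' : Bool}
    (h : TransGen (AltStep d₂.R (d₁.comp d₃).R) (u, c) (v, c')) :
    ∃ b b', TransGen (AltStep (d₁.union d₂).R d₃.R) (u, b) (v, b') ∧
      (u ∈ d₂.V → b = c) ∧ (v ∈ d₂.V → b' = c') := by
  have hd := Finset.disjoint_right.mp h12
  have comp_edge : ∀ {x y}, (d₁.comp d₃).R x y →
      ∃ b b', TransGen (AltStep (d₁.union d₂).R d₃.R) (x, b) (y, b') ∧
        (x ∈ d₂.V → b = true) ∧ (y ∈ d₂.V → b' = false) := by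
    rintro x y ⟨-, -, b, b', h⟩
    refine ⟨b, b', TransGen.mono (fun _ _ => altStep_union_mono) _ _ h, fun hx => ?_, fun hy => ?_⟩
    · have := altStep_left_mem h
      cases b <;> simp_all
    · have := altStep_right_mem h
      cases b' <;> simp_all
  have d₂_edge : ∀ {x y}, d₂.R x y → AltStep (d₁.union d₂).R d₃.R (x, false) (y, true) :=
    fun h => altStep_false.mpr ⟨rfl, .inr h⟩
  generalize hp : (v, c') = p at h
  induction h generalizing v c' with
  | single h =>
    subst hp
    cases c
    · rw [altStep_false] at h
      obtain ⟨rfl, h⟩ := h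
      exact ⟨false, true, .single (d₂_edge h), fun _ => rfl, fun _ => rfl⟩
    · rw [altStep_true] at h
      obtain ⟨rfl, h⟩ := h
      exact comp_edge h
  | @tail p _ hp' h ih =>
    subst hp
    obtain ⟨w, e⟩ := p
    obtain ⟨b, b', h1, h2, h3⟩ := ih rfl
    cases e
    · rw [altStep_false] at h
      obtain ⟨rfl, h⟩ := h
      obtain rfl := h3 (d₂.left_mem h)
      exact ⟨b, true, h1.tail (d₂_edge h), h2, fun _ => rfl⟩
    · rw [altStep_true] at h
      obtain ⟨rfl, h⟩ := h
      have hw : w ∈ d₂.V := by simpa using altStep_right_mem hp'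
      obtain rfl := h3 hw
      obtain ⟨k, k', h4, h5, h6⟩ := comp_edge h
      obtain rfl := h5 hw
      exact ⟨b, k', h1.trans h4, h2, h6⟩

theorem acyclic_union_iff (h12 : Disjoint d₁.V d₂.V) :
    (d₁.union d₂).Acyclic d₃ ↔ d₁.Acyclic d₃ ∧ d₂.Acyclic (d₁.comp d₃) := by
  constructor
  · intro h
    refine ⟨fun p hp => h p (TransGen.mono (fun _ _ => altStep_union_mono) _ _ hp), ?_⟩
    rintro ⟨x, c⟩ hp
    -- Either colour works: with `false` the cycle leaves `x` by an edge of `d₂`, with `true` it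
    -- arrives by one.
    have hx : x ∈ d₂.V := by
      cases c
      · simpa using altStep_left_mem hp
      · simpa using altStep_right_mem hp
    obtain ⟨b, b', h1, h2, h3⟩ := path_expand h12 hp
    obtain rfl := h2 hx
    obtain rfl := h3 hx
    exact h _ h1
  · rintro ⟨h1, h2⟩ p hp
    rcases path_split hp with h | ⟨y, y', h3, h4, h5⟩
    · exact h1 _ h
    -- The cycle uses `d₂`: rotate it so that it starts just after the edge `h4`, and decompose the
    -- rest.
    · have h6 := h5.trans (ReflTransGen.mono (fun _ _ => altStep_union_mono) _ _ h3)
      obtain ⟨z, hz, h7, h8⟩ := path_decomp h12 (d₂.right_mem h4) h6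
      have := comp_of_reflTransGen h12 h8 hz (d₂.left_mem h4)
      exact h2 (y', true) (TransGen.tail' (h7.tail (altStep_true.mpr ⟨rfl, this⟩))
        (altStep_false.mpr ⟨rfl, h4⟩))

theorem comp_union (h12 : Disjoint d₁.V d₂.V) :
    (d₁.union d₂).comp d₃ = d₂.comp (d₁.comp d₃) := by
  have hd := Finset.disjoint_left.mp h12
  have hV : symmDiff (d₁.V ∪ d₂.V) d₃.V = symmDiff d₂.V (symmDiff d₁.V d₃.V) := by
    ext x
    have := @hd x
    simp only [Finset.mem_symmDiff, Finset.mem_union]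
    tauto
  -- An end of a `d₁`–`d₃` path lies in `d₁` or in `d₃`. Being on the outer boundary, in the first
  -- case it avoids `d₃` and in the second it avoids `d₁`; so it is also on the boundary of the
  -- inner composition.
  have mem_left : ∀ {u p c}, u ∈ symmDiff (d₁.V ∪ d₂.V) d₃.V →
      TransGen (AltStep d₁.R d₃.R) (u, c) p → u ∈ symmDiff d₁.V d₃.V := by
    intro u p c hu h
    have h1 := altStep_left_mem h
    have := @hd u
    simp only [Finset.mem_symmDiff, Finset.mem_union] at hu ⊢
    cases c <;> simp only [if_true, Bool.false_eq_true, if_false] at h1 <;> tauto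
  have mem_right : ∀ {u p c}, u ∈ symmDiff (d₁.V ∪ d₂.V) d₃.V →
      TransGen (AltStep d₁.R d₃.R) p (u, c) → u ∈ symmDiff d₁.V d₃.V := by
    intro u p c hu h
    have h1 := altStep_right_mem h
    have := @hd u
    simp only [Finset.mem_symmDiff, Finset.mem_union] at hu ⊢
    cases c <;> simp only [if_true, Bool.false_eq_true, if_false] at h1 <;> tauto
  ext u v
  · change u ∈ symmDiff (d₁.V ∪ d₂.V) d₃.V ↔ u ∈ symmDiff d₂.V (symmDiff d₁.V d₃.V)
    rw [hV]
  · change (u ∈ symmDiff (d₁.V ∪ d₂.V) d₃.V ∧ v ∈ symmDiff (d₁.V ∪ d₂.V) d₃.V ∧ _) ↔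
      (u ∈ symmDiff d₂.V (symmDiff d₁.V d₃.V) ∧ v ∈ symmDiff d₂.V (symmDiff d₁.V d₃.V) ∧ _)
    rw [← hV]
    refine and_congr_right fun hu => and_congr_right fun hv => ⟨?_, ?_⟩
    · rintro ⟨c, c', h⟩
      rcases path_split h with h | ⟨y, y', h1, h2, h3⟩
      · exact ⟨true, false, .single (altStep_true.mpr
          ⟨rfl, mem_left hu h, mem_right hv h, _, _, h⟩)⟩
      · obtain ⟨z, hz, h4, h5⟩ := path_decomp h12 (d₂.right_mem h2) h3
        -- The stretch before the first edge of `d₂` is empty or forms one composite edge; below,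
        -- the stretch `h5` after the last one is treated alike.
        have start : ∃ b, TransGen (AltStep d₂.R (d₁.comp d₃).R) (u, b) (y', true) := by
          rcases reflTransGen_iff_eq_or_transGen.mp h1 with h | h
          · obtain ⟨rfl, rfl⟩ := Prod.mk.inj h
            exact ⟨false, .single (altStep_false.mpr ⟨rfl, h2⟩)⟩
          · have hy : y ∈ symmDiff d₁.V d₃.V := by
              have h6 := altStep_right_mem h
              have := @hd y
              have := d₂.left_mem h2
              simp only [Bool.false_eq_true, if_false] at h6
              simp only [Finset.mem_symmDiff]
              tauto
            exact ⟨true, (TransGen.single (altStep_true.mpr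
              ⟨rfl, mem_left hu h, hy, _, _, h⟩)).tail (altStep_false.mpr ⟨rfl, h2⟩)⟩
        obtain ⟨b, start⟩ := start
        rcases reflTransGen_iff_eq_or_transGen.mp h5 with h | h
        · obtain ⟨rfl, rfl⟩ := Prod.mk.inj h
          exact ⟨b, true, start.trans_left h4⟩
        · have hz' : z ∈ symmDiff d₁.V d₃.V := by
            have h6 := altStep_left_mem h
            have := @hd z
            simp only [if_true] at h6
            simp only [Finset.mem_symmDiff]
            tauto
          exact ⟨b, false, (start.trans_left h4).tail (altStep_true.mpr
            ⟨rfl, hz', mem_right hv h, _, _, h⟩)⟩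
    · rintro ⟨c, c', h⟩
      obtain ⟨b, b', h, -⟩ := path_expand h12 h
      exact ⟨b, b', h⟩

/-- Cutting against a union amounts to cutting twice. -/
theorem cut_union (h12 : Disjoint d₁.V d₂.V) :
    (d₁.union d₂).cut d₃ = (d₁.cut d₃).bind d₂.cut := by
  have := acyclic_union_iff (d₃ := d₃) h12
  by_cases h1 : d₁.Acyclic d₃
  · by_cases h2 : d₂.Acyclic (d₁.comp d₃)
    · simp [cut, h1, h2, this, comp_union h12]
    · simp [cut, h1, h2, this]
  · simp [cut, h1, this]

end Assoc

end Den


/-! ### Deterministic graphs of weight one and their denotations -/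

namespace WGraph

variable {α : Type}

/-- `G` has denotation `d`: its edges have weight one, at most one edge leaves each vertex, and `d`
is the relation given by the edges of `G`. -/
structure Denotes (G : WGraph α) (d : Den α) : Prop where
  weight : ∀ e, G.ω e = 1
  inj : Function.Injective G.s
  V_eq : G.V = d.V
  rel : ∀ x y, d.R x y ↔ ∃ e, G.s e = x ∧ G.t e = y

/-- An edge is determined by its source, so the edges of either graph correspond to the related
pairs of `d`, and matching sources and targets gives the bijection. -/
theorem Denotes.same {G H : WGraph α} {d : Den α} (hG : G.Denotes d) (hH : H.Denotes d) :
    G.Same H := by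
  refine ⟨hG.V_eq.trans hH.V_eq.symm, ?_⟩
  have key : ∀ {G H : WGraph α}, G.Denotes d → H.Denotes d →
      ∀ e : G.E, ∃ f : H.E, H.s f = G.s e ∧ H.t f = G.t e := fun hG hH e =>
    (hH.rel _ _).mp ((hG.rel _ _).mpr ⟨e, rfl, rfl⟩)
  choose φ hs ht using key hG hH
  refine ⟨Equiv.ofBijective φ ⟨fun e e' h => hG.inj ?_, fun f => ?_⟩, fun e =>
    ⟨hs e, ht e, (hH.weight _).trans (hG.weight _).symm⟩⟩
  · rw [← hs, ← hs, h]
  · obtain ⟨e, he, -⟩ := key hH hG f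
    exact ⟨e, hH.inj ((hs e).trans he)⟩

theorem empty_denotes : (empty α).Denotes (Den.empty α) where
  weight e := e.elim
  inj e := e.elim
  V_eq := rfl
  rel _ _ := ⟨fun h => h.elim, fun ⟨e, _⟩ => e.elim⟩

variable [DecidableEq α]

/-- The relation exchanging `a ∈ A` and `φ a`. -/
def _root_.LocMLL.Den.fax (A : Finset α) (φ : α → α) : Den α where
  V := A ∪ A.image φ
  R x y := x ∈ A ∧ y = φ x ∨ y ∈ A ∧ x = φ y
  left_mem := by
    rintro x y (⟨h, rfl⟩ | ⟨h, rfl⟩)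
    · exact Finset.mem_union_left _ h
    · exact Finset.mem_union_right _ (Finset.mem_image_of_mem φ h)
  right_mem := by
    rintro x y (⟨h, rfl⟩ | ⟨h, rfl⟩)
    · exact Finset.mem_union_right _ (Finset.mem_image_of_mem φ h)
    · exact Finset.mem_union_left _ h

theorem fax_denotes {A : Finset α} {φ : α → α} (hφ : Set.InjOn φ A)
    (hA : Disjoint A (A.image φ)) : (fax A φ).Denotes (Den.fax A φ) where
  weight _ := rfl
  inj := by
    have h : ∀ a ∈ A, ∀ b ∈ A, a ≠ φ b := fun a ha b hb e =>
      Finset.disjoint_left.mp hA ha (e ▸ Finset.mem_image_of_mem φ hb)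
    rintro ⟨⟨a, ha⟩, b⟩ ⟨⟨a', ha'⟩, b'⟩ e
    cases b <;> cases b' <;> simp only [fax, if_true, Bool.false_eq_true, if_false] at e
    · obtain rfl := hφ ha ha' e
      rfl
    · exact (h _ ha' _ ha e.symm).elim
    · exact (h _ ha _ ha' e).elim
    · subst e
      rfl
  V_eq := rfl
  rel x y := by
    constructor
    · rintro (⟨h, rfl⟩ | ⟨h, rfl⟩)
      · exact ⟨(⟨x, h⟩, true), rfl, rfl⟩
      · exact ⟨(⟨y, h⟩, false), rfl, rfl⟩
    · rintro ⟨⟨⟨a, ha⟩, b⟩, rfl, rfl⟩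
      cases b
      · exact .inr ⟨ha, rfl⟩
      · exact .inl ⟨ha, rfl⟩

variable {G H : WGraph α} {d e : Den α}

theorem Denotes.union (hG : G.Denotes d) (hH : H.Denotes e) (h : Disjoint G.V H.V) :
    (G.union H).Denotes (d.union e) where
  weight := Sum.rec hG.weight hH.weight
  inj := by
    refine hG.inj.sumElim hH.inj fun a b hab => ?_
    exact Finset.disjoint_left.mp h (G.s_mem a) (hab ▸ H.s_mem b)
  V_eq := by simp only [WGraph.union, Den.union, hG.V_eq, hH.V_eq]
  rel x y := by
    simp [WGraph.union, Den.union, hG.rel, hH.rel]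

/-! ### Alternating paths of edges as paths of coloured states. -/

/-- The state from which an edge of the plugging can be followed. -/
def srcState (G H : WGraph α) (a : G.E ⊕ H.E) : α × Bool := ((G.union H).s a, a.isRight)

/-- The state reached by an edge of the plugging. -/
def tgtState (G H : WGraph α) (a : G.E ⊕ H.E) : α × Bool := ((G.union H).t a, !a.isRight)

/-- The colour of a state names the graph to be used next, so the alternation condition becomes
plain equality of states. -/
theorem altNext_iff {a b : G.E ⊕ H.E} : AltNext G H a b ↔ tgtState G H a = srcState G H b := by
  rcases a with a | a <;> rcases b with b | b <;> simp [AltNext, tgtState, srcState]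

theorem altStep_iff (hG : G.Denotes d) (hH : H.Denotes e) {p q : α × Bool} :
    AltStep d.R e.R p q ↔ ∃ a, srcState G H a = p ∧ tgtState G H a = q := by
  obtain ⟨x, c⟩ := p
  obtain ⟨y, c'⟩ := q
  cases c
  · simp only [altStep_false, hG.rel, srcState, tgtState, WGraph.union, Prod.mk.injEq, Sum.exists,
      Sum.elim_inl, Sum.elim_inr, Sum.isRight_inl, Sum.isRight_inr]
    aesop
  · simp only [altStep_true, hH.rel, srcState, tgtState, WGraph.union, Prod.mk.injEq, Sum.exists,
      Sum.elim_inl, Sum.elim_inr, Sum.isRight_inl, Sum.isRight_inr]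
    aesop

theorem transGen_of_chain (hG : G.Denotes d) (hH : H.Denotes e) :
    ∀ (l : List (G.E ⊕ H.E)) (hl : l ≠ []), l.IsChain (AltNext G H) →
      TransGen (AltStep d.R e.R) (srcState G H (l.head hl)) (tgtState G H (l.getLast hl))
  | [a], _, _ => .single ((altStep_iff hG hH).mpr ⟨a, rfl, rfl⟩)
  | a :: b :: l, _, h => by
    rw [List.isChain_cons_cons] at h
    have ih := transGen_of_chain hG hH (b :: l) (by simp) h.2
    refine TransGen.head ((altStep_iff hG hH).mpr ⟨a, rfl, altNext_iff.mp h.1⟩) ?_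
    simpa using ih

theorem exists_chain_of_transGen (hG : G.Denotes d) (hH : H.Denotes e) {p q : α × Bool}
    (h : TransGen (AltStep d.R e.R) p q) :
    ∃ (l : List (G.E ⊕ H.E)) (hl : l ≠ []), l.IsChain (AltNext G H) ∧
      srcState G H (l.head hl) = p ∧ tgtState G H (l.getLast hl) = q := by
  induction h using TransGen.head_induction_on with
  | single h =>
    obtain ⟨a, h1, h2⟩ := (altStep_iff hG hH).mp h
    exact ⟨[a], by simp, by simp, h1, h2⟩
  | head h _ ih =>
    obtain ⟨a, h1, h2⟩ := (altStep_iff hG hH).mp h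
    obtain ⟨l, hl, h3, h4, h5⟩ := ih
    obtain ⟨b, l, rfl⟩ := List.exists_cons_of_ne_nil hl
    refine ⟨a :: b :: l, by simp, ?_, h1, by simpa using h5⟩
    exact List.isChain_cons_cons.mpr ⟨altNext_iff.mpr (h2.trans h4.symm), h3⟩

theorem srcState_injective (hG : Function.Injective G.s) (hH : Function.Injective H.s) :
    Function.Injective (srcState G H) := by
  rintro (a | a) (b | b) h
  · exact congrArg _ (hG (Prod.mk.inj h).1)
  · simp [srcState] at h
  · simp [srcState] at h
  · exact congrArg _ (hH (Prod.mk.inj h).1)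

/-- Edges of both graphs meet at an inner vertex of an alternating path. A path that has reached the
symmetric difference therefore cannot be continued. -/
theorem altNext_mem_inter {a b : G.E ⊕ H.E} (h : AltNext G H a b) :
    (G.union H).t a ∉ symmDiff G.V H.V := by
  have : (G.union H).t a ∈ G.V ∧ (G.union H).t a ∈ H.V := by
    obtain ⟨h1, h2⟩ := h
    rcases a with a | a <;> rcases b with b | b
    · simp at h2
    · exact ⟨G.t_mem a, h1 ▸ H.s_mem b⟩
    · exact ⟨h1 ▸ G.s_mem b, H.t_mem a⟩
    · simp at h2
  simp [Finset.mem_symmDiff, this]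

/-- In deterministic graphs, the alternating paths with a given start and ending in the symmetric
difference of the carriers are unique. -/
theorem chain_unique (hG : Function.Injective G.s) (hH : Function.Injective H.s) :
    ∀ (l m : List (G.E ⊕ H.E)) (hl : l ≠ []) (hm : m ≠ []), l.IsChain (AltNext G H) →
      m.IsChain (AltNext G H) → srcState G H (l.head hl) = srcState G H (m.head hm) →
      (G.union H).t (l.getLast hl) ∈ symmDiff G.V H.V →
      (G.union H).t (m.getLast hm) ∈ symmDiff G.V H.V → l = m
  | [a], [b], _, _, _, _, h, _, _ => by
    simpa using srcState_injective hG hH h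
  | [a], b :: c :: m, _, _, _, h2, h, h3, _ => by
    obtain rfl : a = b := srcState_injective hG hH h
    exact (altNext_mem_inter (List.isChain_cons_cons.mp h2).1 h3).elim
  | a :: c :: l, [b], _, _, h1, _, h, _, h4 => by
    obtain rfl : a = b := srcState_injective hG hH h
    exact (altNext_mem_inter (List.isChain_cons_cons.mp h1).1 h4).elim
  | a :: c :: l, b :: f :: m, _, _, h1, h2, h, h3, h4 => by
    obtain rfl : a = b := srcState_injective hG hH h
    rw [List.isChain_cons_cons] at h1 h2
    have := chain_unique hG hH (c :: l) (f :: m) (by simp) (by simp) h1.2 h2.2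
      ((altNext_iff.mp h1.1).symm.trans (altNext_iff.mp h2.1)) (by simpa using h3)
      (by simpa using h4)
    rw [this]

theorem isRight_iff_of_mem_symmDiff {a : G.E ⊕ H.E}
    (h : (G.union H).s a ∈ symmDiff G.V H.V) : a.isRight = true ↔ (G.union H).s a ∈ H.V := by
  rcases a with a | a
  · have h1 : (G.union H).s (.inl a) ∈ G.V := G.s_mem a
    simp_all [Finset.mem_symmDiff]
  · have h1 : (G.union H).s (.inr a) ∈ H.V := H.s_mem a
    simp_all

/-- The point is that determinism survives: the relation records only that a path exists, whereas
the reduction has one edge per path. -/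
theorem Denotes.reduction (hG : G.Denotes d) (hH : H.Denotes e) :
    (G.reduction H).Denotes (d.comp e) where
  weight p := by
    refine List.prod_eq_one fun w hw => ?_
    obtain ⟨a, -, rfl⟩ := List.mem_map.mp hw
    rcases a with a | a
    · exact hG.weight a
    · exact hH.weight a
  inj := by
    rintro ⟨l, hl, h1, h2, h3⟩ ⟨m, hm, h4, h5, h6⟩ h
    replace h : (G.union H).s (l.head hl) = (G.union H).s (m.head hm) := h
    -- A boundary vertex belongs to only one of the two carriers, which fixes the colour of the
    -- first edge.
    have hc : (l.head hl).isRight = (m.head hm).isRight := by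
      rw [Bool.eq_iff_iff, isRight_iff_of_mem_symmDiff h2, isRight_iff_of_mem_symmDiff h5, h]
    obtain rfl := chain_unique hG.inj hH.inj l m hl hm h1 h4 (Prod.ext h hc) h3 h6
    rfl
  V_eq := by simp only [WGraph.reduction, Den.comp, hG.V_eq, hH.V_eq]
  rel x y := by
    simp only [Den.comp, ← hG.V_eq, ← hH.V_eq]
    constructor
    · rintro ⟨hx, hy, c, c', h⟩
      obtain ⟨l, hl, h1, h2, h3⟩ := exists_chain_of_transGen hG hH h
      have hs : (G.union H).s (l.head hl) = x := congrArg Prod.fst h2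
      have ht : (G.union H).t (l.getLast hl) = y := congrArg Prod.fst h3
      exact ⟨⟨l, hl, h1, hs ▸ hx, ht ▸ hy⟩, hs, ht⟩
    · rintro ⟨⟨l, hl, h1, h2, h3⟩, rfl, rfl⟩
      exact ⟨h2, h3, _, _, transGen_of_chain hG hH l hl h1⟩

/-- A circuit closes up with a change of graph, hence returns to its initial state and is a cycle
for `AltStep`. Without cycles the sum is empty. -/
theorem Denotes.interaction_eq_zero (hG : G.Denotes d) (hH : H.Denotes e) (h : d.Acyclic e) :
    G.interaction H = 0 := by
  have : IsEmpty (circuits G H) := by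
    refine ⟨?_⟩
    rintro ⟨c, l, ⟨h1, hl, h2⟩, -⟩
    have := transGen_of_chain hG hH l hl h1
    rw [altNext_iff.mp h2] at this
    exact h _ this
  unfold interaction
  exact tsum_empty

end WGraph

namespace Project

variable {α : Type}

/-- `a` has wager `0` and its graph has denotation `d`. -/
def Denotes (a : Project α) (d : Den α) : Prop :=
  a.wager = 0 ∧ a.graph.Denotes d

theorem Denotes.same {a b : Project α} {d : Den α} (ha : a.Denotes d) (hb : b.Denotes d) :
    a.Same b :=
  ⟨ha.1.trans hb.1.symm, ha.2.same hb.2⟩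

variable [DecidableEq α] {a b : Project α} {d e f : Den α}

theorem Denotes.tensor (ha : a.Denotes d) (hb : b.Denotes e) (h : Disjoint d.V e.V) :
    ∃ c, a.tensor b = some c ∧ c.Denotes (d.union e) := by
  rw [← ha.2.V_eq, ← hb.2.V_eq] at h
  exact ⟨_, if_pos h, by simp [ha.1, hb.1], ha.2.union hb.2 h⟩

theorem Denotes.cut (ha : a.Denotes d) (hb : b.Denotes e) (h : d.cut e = some f) :
    ∃ c, a.cut b = some c ∧ c.Denotes f := by
  by_cases hac : d.Acyclic e
  · rw [Den.cut, if_pos hac, Option.some_inj] at h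
    subst h
    have hm : a.meas b = 0 := by
      simp [meas, ha.1, hb.1, ha.2.interaction_eq_zero hb.2 hac]
    exact ⟨_, if_neg (by simp [hm]), by simp [hm], ha.2.reduction hb.2⟩
  · simp [Den.cut, hac] at h

end Project


/-! ### Denotations of proofs -/

namespace Den

variable {α : Type} [DecidableEq α]

/-- The relation exchanging `u t` and `v t`. -/
def link {ι : Type} [Fintype ι] (u v : ι → α) : Den α where
  V := Finset.univ.image u ∪ Finset.univ.image v
  R x y := ∃ t, x = u t ∧ y = v t ∨ x = v t ∧ y = u t
  left_mem := by
    rintro _ _ ⟨t, ⟨rfl, -⟩ | ⟨rfl, -⟩⟩ <;> simp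
  right_mem := by
    rintro _ _ ⟨t, ⟨-, rfl⟩ | ⟨-, rfl⟩⟩ <;> simp

theorem cut_link {ι : Type} [Fintype ι] {u v w : ι → α} (hv : Function.Injective v)
    (huv : ∀ s t, u s ≠ v t) (hvw : ∀ s t, v s ≠ w t) (huw : ∀ s t, u s ≠ w t) :
    (link u v).cut (link v w) = some (link u w) := by
  -- No alternating path has more than two edges: from `u` or `w` it crosses `v` once and stops. The
  -- six cases are the possible pairs of end states.
  have paths : ∀ {p q}, TransGen (AltStep (link u v).R (link v w).R) p q → ∃ t,
      (p = (u t, false) ∧ q = (v t, true)) ∨ (p = (u t, false) ∧ q = (w t, false)) ∨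
      (p = (v t, true) ∧ q = (w t, false)) ∨ (p = (w t, true) ∧ q = (v t, false)) ∨
      (p = (w t, true) ∧ q = (u t, true)) ∨ (p = (v t, false) ∧ q = (u t, true)) := by
    have single : ∀ {p q}, AltStep (link u v).R (link v w).R p q → ∃ t,
        (p = (u t, false) ∧ q = (v t, true)) ∨ (p = (v t, true) ∧ q = (w t, false)) ∨
        (p = (w t, true) ∧ q = (v t, false)) ∨ (p = (v t, false) ∧ q = (u t, true)) := by
      rintro ⟨x, c⟩ ⟨y, c'⟩ h
      cases c
      · rw [altStep_false] at h
        obtain ⟨rfl, t, ⟨rfl, rfl⟩ | ⟨rfl, rfl⟩⟩ := h <;> exact ⟨t, by simp⟩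
      · rw [altStep_true] at h
        obtain ⟨rfl, t, ⟨rfl, rfl⟩ | ⟨rfl, rfl⟩⟩ := h <;> exact ⟨t, by simp⟩
    intro p q h
    induction h with
    | single h =>
      obtain ⟨t, h⟩ := single h
      exact ⟨t, by tauto⟩
    | tail _ h₀ ih =>
      obtain ⟨t, ih⟩ := ih
      obtain ⟨s, h⟩ := single h₀
      clear h₀
      refine ⟨t, ?_⟩
      have h1 := huv s t
      have h2 := huv t s
      have h3 := hvw s t
      have h4 := hvw t s
      have h5 := huw s t
      have h6 := huw t s
      have h7 : v t = v s → t = s := fun h => hv h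
      rcases ih with ⟨rfl, rfl⟩ | ⟨rfl, rfl⟩ | ⟨rfl, rfl⟩ | ⟨rfl, rfl⟩ | ⟨rfl, rfl⟩ | ⟨rfl, rfl⟩ <;>
        rcases h with ⟨h, rfl⟩ | ⟨h, rfl⟩ | ⟨h, rfl⟩ | ⟨h, rfl⟩ <;>
        simp only [Prod.mk.injEq, Bool.false_eq_true, Bool.true_eq_false, and_false, and_true]
          at h <;>
        -- A continuation either identifies locations of two different families, which is excluded,
        -- or matches `v t` with `v s`, and then injectivity of `v` forces equal indices.
        first
        | exact absurd h ‹_›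
        | exact absurd h.symm ‹_›
        | (obtain rfl := h7 h; simp)
  have hac : (link u v).Acyclic (link v w) := by
    intro p hp
    obtain ⟨t, h⟩ := paths hp
    rcases h with ⟨rfl, h⟩ | ⟨rfl, h⟩ | ⟨rfl, h⟩ | ⟨rfl, h⟩ | ⟨rfl, h⟩ | ⟨rfl, h⟩ <;>
      simp only [Prod.mk.injEq, Bool.false_eq_true, Bool.true_eq_false, and_false, and_true] at h
    · exact huw _ _ h
    · exact huw _ _ h.symm
  rw [cut, if_pos hac]
  have hV : symmDiff (link u v).V (link v w).V = (link u w).V := by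
    ext x
    have h1 : ∀ s t, u s = x → v t = x → False := fun s t h h' => huv s t (h.trans h'.symm)
    have h2 : ∀ s t, v s = x → w t = x → False := fun s t h h' => hvw s t (h.trans h'.symm)
    have h3 : ∀ s t, u s = x → w t = x → False := fun s t h h' => huw s t (h.trans h'.symm)
    simp only [link, Finset.mem_symmDiff, Finset.mem_union, Finset.mem_image, Finset.mem_univ,
      true_and]
    grind
  have hv' : ∀ t, v t ∉ (link u w).V := by
    intro t h
    simp only [link, Finset.mem_union, Finset.mem_image, Finset.mem_univ, true_and] at h
    rcases h with ⟨s, h⟩ | ⟨s, h⟩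
    · exact huv _ _ h
    · exact hvw _ _ h.symm
  congr 1
  ext x y
  · simp [comp, hV]
  · simp only [comp, hV]
    constructor
    · rintro ⟨hx, hy, c, c', h⟩
      obtain ⟨t, h⟩ := paths h
      refine ⟨t, ?_⟩
      simp only [Prod.mk.injEq] at h
      rcases h with ⟨⟨rfl, -⟩, rfl, -⟩ | ⟨⟨rfl, -⟩, rfl, -⟩ | ⟨⟨rfl, -⟩, rfl, -⟩ |
        ⟨⟨rfl, -⟩, rfl, -⟩ | ⟨⟨rfl, -⟩, rfl, -⟩ | ⟨⟨rfl, -⟩, rfl, -⟩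
      · exact absurd hy (hv' t)
      · exact .inl ⟨rfl, rfl⟩
      · exact absurd hx (hv' t)
      · exact absurd hy (hv' t)
      · exact .inr ⟨rfl, rfl⟩
      · exact absurd hx (hv' t)
    · intro h
      refine ⟨(link u w).left_mem h, (link u w).right_mem h, ?_⟩
      obtain ⟨t, ⟨rfl, rfl⟩ | ⟨rfl, rfl⟩⟩ := h
      · exact ⟨false, false, (TransGen.single (altStep_false.mpr
          ⟨rfl, t, .inl ⟨rfl, rfl⟩⟩)).tail (altStep_true.mpr ⟨rfl, t, .inl ⟨rfl, rfl⟩⟩)⟩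
      · exact ⟨true, true, (TransGen.single (altStep_true.mpr
          ⟨rfl, t, .inr ⟨rfl, rfl⟩⟩)).tail (altStep_false.mpr ⟨rfl, t, .inr ⟨rfl, rfl⟩⟩)⟩

/-- When `d₂` also avoids `d₃`, the second cut in `cut_union` is between disjoint carriers, hence a
union. -/
theorem cut_union_left {d₁ d₂ d₃ : Den α} (h12 : Disjoint d₁.V d₂.V) (h23 : Disjoint d₂.V d₃.V) :
    (d₁.union d₂).cut d₃ = (d₁.cut d₃).bind fun a => some (a.union d₂) := by
  rw [cut_union h12]
  by_cases h : d₁.Acyclic d₃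
  · have hd : Disjoint d₂.V (d₁.comp d₃).V :=
      (Finset.disjoint_union_right.mpr ⟨h12.symm, h23⟩).mono_right symmDiff_le_sup
    simp only [cut, if_pos h, Option.bind_some]
    exact (cut_of_disjoint hd).trans (congrArg some (union_comm _ _))
  · simp [cut, h]

theorem cut_union_right {d₁ d₂ d₃ : Den α} (h12 : Disjoint d₁.V d₂.V)
    (h13 : Disjoint d₁.V d₃.V) :
    (d₁.union d₂).cut d₃ = (d₂.cut d₃).bind fun a => some (d₁.union a) := by
  simpa only [union_comm] using cut_union_left h12.symm h13

/-- Both sides are the cut of `d₁` against the union of `d₂` and `d₃`, split in the two possible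
orders. -/
theorem cut_cut_left {d₁ d₂ d₃ : Den α} (h23 : Disjoint d₂.V d₃.V) :
    ((d₁.cut d₂).bind fun a => a.cut d₃) = (d₁.cut d₃).bind fun a => a.cut d₂ := by
  have h1 := cut_union (d₃ := d₁) h23
  have h2 := cut_union (d₃ := d₁) h23.symm
  rw [union_comm, h1] at h2
  simp only [cut_comm d₁, fun a => cut_comm a d₂, fun a => cut_comm a d₃]
  exact h2

theorem cut_cut_right {d₁ d₂ d₃ : Den α} (h13 : Disjoint d₁.V d₃.V) :
    ((d₁.cut d₂).bind fun a => a.cut d₃) = (d₂.cut d₃).bind fun a => d₁.cut a := by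
  rw [cut_comm d₁ d₂, cut_cut_left h13]
  simp only [fun a => cut_comm a d₁]

theorem empty_cut (d : Den α) : (empty α).cut d = some d := by
  rw [cut_of_disjoint (Finset.disjoint_empty_left _), empty_union]

end Den

/-! ### Axiom links and their composition. -/

section Axioms

variable {n : ℕ → ℕ} {i : ℕ}

/-- The `t`-th location of `X_i(j)`. -/
def locAt (n : ℕ → ℕ) (i j : ℕ) (t : Fin (n i)) : ℕ × ℕ := (i, j * n i + t)

theorem locAt_mem (j : ℕ) (t : Fin (n i)) : locAt n i j t ∈ varLoc n i j := by
  have := t.2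
  simp only [locAt, varLoc, Finset.mem_product, Finset.mem_singleton, Finset.mem_Ico, true_and]
  constructor
  · omega
  · rw [add_mul]
    omega

theorem mem_varLoc_iff {j : ℕ} {x : ℕ × ℕ} : x ∈ varLoc n i j ↔ ∃ t, x = locAt n i j t := by
  constructor
  · intro h
    obtain ⟨a, m⟩ := x
    simp only [varLoc, Finset.mem_product, Finset.mem_singleton, Finset.mem_Ico, add_mul,
      one_mul] at h
    obtain ⟨rfl, h1, h2⟩ := h
    exact ⟨⟨m - j * n a, by omega⟩, by simp only [locAt, Prod.mk.injEq, true_and]; omega⟩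
  · rintro ⟨t, rfl⟩
    exact locAt_mem j t

theorem locAt_injective (j : ℕ) : Function.Injective (locAt n i j) := by
  intro s t h
  simp only [locAt, Prod.mk.injEq, true_and, add_right_inj] at h
  exact Fin.ext h

theorem locAt_ne {j k : ℕ} (h : j ≠ k) (s t : Fin (n i)) : locAt n i j s ≠ locAt n i k t :=
  fun e => Finset.disjoint_left.mp (varLoc_disjoint n i j k h) (locAt_mem j s) (e ▸ locAt_mem k t)

theorem axShift_locAt (j k : ℕ) (t : Fin (n i)) :
    (i, k * n i + ((locAt n i j t).2 - j * n i)) = locAt n i k t := by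
  simp [locAt]

/-- The denotation of an axiom. -/
def axDen (n : ℕ → ℕ) (i j k : ℕ) : Den (ℕ × ℕ) :=
  Den.link (locAt n i j) (locAt n i k)

theorem image_locAt (j : ℕ) : Finset.univ.image (locAt n i j) = varLoc n i j := by
  ext x
  simp [mem_varLoc_iff, eq_comm]

theorem image_axShift (j k : ℕ) :
    (varLoc n i j).image (fun p => (i, k * n i + (p.2 - j * n i))) = varLoc n i k := by
  rw [← image_locAt j, Finset.image_image, ← image_locAt k]
  congr 1
  ext1 t
  exact axShift_locAt j k t

theorem axDen_V (j k : ℕ) : (axDen n i j k).V = varLoc n i j ∪ varLoc n i k := by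
  simp only [axDen, Den.link, image_locAt]

theorem axFax_denotes {j k : ℕ} (h : j ≠ k) : (axFax n i j k).Denotes (axDen n i j k) := by
  refine ⟨rfl, ?_⟩
  have key : axDen n i j k = Den.fax (varLoc n i j) fun p => (i, k * n i + (p.2 - j * n i)) := by
    ext x y
    · rw [axDen_V]
      simp only [Den.fax, image_axShift]
    · simp only [axDen, Den.link, Den.fax, mem_varLoc_iff]
      constructor
      · rintro ⟨t, ⟨rfl, rfl⟩ | ⟨rfl, rfl⟩⟩
        · exact .inl ⟨⟨t, rfl⟩, (axShift_locAt j k t).symm⟩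
        · exact .inr ⟨⟨t, rfl⟩, (axShift_locAt j k t).symm⟩
      · rintro (⟨⟨t, rfl⟩, rfl⟩ | ⟨⟨t, rfl⟩, rfl⟩)
        · exact ⟨t, .inl ⟨rfl, axShift_locAt j k t⟩⟩
        · exact ⟨t, .inr ⟨axShift_locAt j k t, rfl⟩⟩
  rw [key]
  refine WGraph.fax_denotes ?_ ?_
  · intro x hx y hy hxy
    obtain ⟨s, rfl⟩ := mem_varLoc_iff.mp hx
    obtain ⟨t, rfl⟩ := mem_varLoc_iff.mp hy
    have hxy' : locAt n i k s = locAt n i k t := by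
      rw [← axShift_locAt j k s, ← axShift_locAt j k t]
      exact hxy
    rw [locAt_injective k hxy']
  · rw [image_axShift]
    exact varLoc_disjoint n i j k h

theorem axDen_cut {j k l : ℕ} (hjk : j ≠ k) (hkl : k ≠ l) (hjl : j ≠ l) :
    (axDen n i j k).cut (axDen n i k l) = some (axDen n i j l) :=
  Den.cut_link (locAt_injective k) (locAt_ne hjk) (locAt_ne hkl) (locAt_ne hjl)

end Axioms

/-- The denotation of a proof; it is `none` if an alternating cycle appears in some cut. -/
noncomputable def den (n : ℕ → ℕ) : Tree → Option (Den (ℕ × ℕ))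
  | Tree.ax i j k => some (axDen n i j k)
  | Tree.cut _ π ρ => (den n π).bind fun a => (den n ρ).bind fun b => a.cut b
  | Tree.tensor _ _ π ρ => (den n π).bind fun a => (den n ρ).bind fun b => some (a.union b)
  | Tree.par _ _ π => den n π
  | Tree.one => some (Den.empty (ℕ × ℕ))
  | Tree.bot π => den n π
  | Tree.mix π ρ => (den n π).bind fun a => (den n ρ).bind fun b => some (a.union b)

@[simp]
theorem Formula.dual_dual (A : Formula) : A.dual.dual = A := by
  induction A <;> simp_all [Formula.dual]

@[simp]
theorem Formula.loc_dual (n : ℕ → ℕ) (A : Formula) : A.dual.loc n = A.loc n := by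
  induction A <;> simp_all [Formula.dual, Formula.loc]

/-- Converts side conditions on locations into disjointness of carriers. In a cut, the location of
the cut formula is common to both premises and vanishes from the symmetric difference, while the
disjoint contexts remain. -/
theorem den_V {n : ℕ → ℕ} {π : Tree} {Γ : Multiset Formula} (h : Derives n π Γ) :
    ∀ {d}, den n π = some d → d.V = seqLoc n Γ := by
  induction h with
  | ax i j k _ =>
    intro d hd
    obtain rfl := Option.some_inj.mp hd
    rw [axDen_V]
    simp [seqLoc, Formula.loc]
  | cut A Δ Γ π ρ hπ hρ hloc ih1 ih2 =>
    intro d hd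
    simp only [den, Option.bind_eq_some_iff] at hd
    obtain ⟨a, ha, b, hb, hd⟩ := hd
    have h1 := hπ.isSequent
    have h2 := hρ.isSequent
    rw [isSequent_cons] at h1 h2
    rw [Formula.loc_dual] at h2
    by_cases hac : a.Acyclic b
    · rw [Den.cut, if_pos hac, Option.some_inj] at hd
      subst hd
      simp only [Den.comp, ih1 ha, ih2 hb, seqLoc_cons, seqLoc_add, Formula.loc_dual]
      have h1 := Finset.disjoint_left.mp h1.2.1
      have h2 := Finset.disjoint_left.mp h2.2.1
      have h3 := Finset.disjoint_left.mp hloc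
      ext x
      have := @h1 x
      have := @h2 x
      have := @h3 x
      simp only [Finset.mem_symmDiff, Finset.mem_union]
      tauto
    · simp [Den.cut, hac] at hd
  | tensor A B Δ Γ π ρ _ _ _ ih1 ih2 =>
    intro d hd
    simp only [den, Option.bind_eq_some_iff] at hd
    obtain ⟨a, ha, b, hb, hd⟩ := hd
    obtain rfl := Option.some_inj.mp hd
    simp only [Den.union, ih1 ha, ih2 hb, seqLoc_cons, seqLoc_add, Formula.loc]
    ext x
    simp only [Finset.mem_union]
    tauto
  | par A B Γ π _ ih =>
    intro d hd
    rw [ih hd]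
    simp only [seqLoc_cons, Formula.loc, Finset.union_assoc]
  | one =>
    intro d hd
    obtain rfl := Option.some_inj.mp hd
    simp [Den.empty, seqLoc, Formula.loc]
  | bot Γ π _ ih =>
    intro d hd
    rw [ih hd]
    simp [seqLoc_cons, Formula.loc]
  | mix Γ Δ π ρ _ _ _ ih1 ih2 =>
    intro d hd
    simp only [den, Option.bind_eq_some_iff] at hd
    obtain ⟨a, ha, b, hb, hd⟩ := hd
    obtain rfl := Option.some_inj.mp hd
    simp only [Den.union, ih1 ha, ih2 hb, seqLoc_add]

/-- When the denotation of a derivation is defined, so is its interpretation, and the latter has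
the former as denotation. -/
theorem interp_denotes {n : ℕ → ℕ} (Φ : Basis n) {π : Tree} {Γ : Multiset Formula}
    (h : Derives n π Γ) :
    ∀ {d}, den n π = some d → ∃ a, interp Φ π = some a ∧ a.Denotes d := by
  induction h with
  | ax i j k hjk =>
    intro d hd
    obtain rfl := Option.some_inj.mp hd
    exact ⟨_, rfl, axFax_denotes hjk⟩
  | cut A Δ Γ π ρ _ _ _ ih1 ih2 =>
    intro d hd
    simp only [den, Option.bind_eq_some_iff] at hd
    obtain ⟨d₁, h1, d₂, h2, hd⟩ := hd
    obtain ⟨a, ha, ha'⟩ := ih1 h1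
    obtain ⟨b, hb, hb'⟩ := ih2 h2
    simpa [interp, ha, hb] using ha'.cut hb' hd
  | tensor A B Δ Γ π ρ hπ hρ hloc ih1 ih2 =>
    intro d hd
    simp only [den, Option.bind_eq_some_iff] at hd
    obtain ⟨d₁, h1, d₂, h2, hd⟩ := hd
    obtain rfl := Option.some_inj.mp hd
    obtain ⟨a, ha, ha'⟩ := ih1 h1
    obtain ⟨b, hb, hb'⟩ := ih2 h2
    rw [← den_V hπ h1, ← den_V hρ h2] at hloc
    simpa [interp, ha, hb] using ha'.tensor hb' hloc
  | par A B Γ π _ ih => exact ih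
  | one =>
    intro d hd
    obtain rfl := Option.some_inj.mp hd
    exact ⟨_, rfl, rfl, WGraph.empty_denotes⟩
  | bot Γ π _ ih => exact ih
  | mix Γ Δ π ρ hπ hρ hloc ih1 ih2 =>
    intro d hd
    simp only [den, Option.bind_eq_some_iff] at hd
    obtain ⟨d₁, h1, d₂, h2, hd⟩ := hd
    obtain rfl := Option.some_inj.mp hd
    obtain ⟨a, ha, ha'⟩ := ih1 h1
    obtain ⟨b, hb, hb'⟩ := ih2 h2
    rw [← den_V hπ h1, ← den_V hρ h2] at hloc
    simpa [interp, ha, hb] using ha'.tensor hb' hloc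

/-- Only cut is partial on denotations: `Den.union` is total, with no disjointness to check. -/
theorem exists_den_of_cutFree (n : ℕ → ℕ) : ∀ π : Tree, π.CutFree → ∃ d, den n π = some d
  | Tree.ax _ _ _, _ => ⟨_, rfl⟩
  | Tree.tensor _ _ π ρ, h => by
    obtain ⟨d, hd⟩ := exists_den_of_cutFree n π h.1
    obtain ⟨e, he⟩ := exists_den_of_cutFree n ρ h.2
    exact ⟨d.union e, by simp [den, hd, he]⟩
  | Tree.par _ _ π, h => exists_den_of_cutFree n π h
  | Tree.one, _ => ⟨_, rfl⟩
  | Tree.bot π, h => exists_den_of_cutFree n π h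
  | Tree.mix π ρ, h => by
    obtain ⟨d, hd⟩ := exists_den_of_cutFree n π h.1
    obtain ⟨e, he⟩ := exists_den_of_cutFree n ρ h.2
    exact ⟨d.union e, by simp [den, hd, he]⟩


/-! ### Subject reduction and invariance -/

section Inversion

variable {n : ℕ → ℕ} {Θ : Multiset Formula} {A B : Formula} {π ρ : Tree}

theorem derives_ax_iff {i j k : ℕ} :
    Derives n (Tree.ax i j k) Θ ↔ j ≠ k ∧ Θ = {Formula.nvar i j, Formula.var i k} := by
  constructor
  · rintro ⟨⟩
    exact ⟨‹_›, rfl⟩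
  · rintro ⟨h, rfl⟩
    exact .ax _ _ _ h

theorem derives_cut_iff :
    Derives n (Tree.cut A π ρ) Θ ↔ ∃ Δ Γ, Θ = Δ + Γ ∧ Derives n π (A ::ₘ Δ) ∧
      Derives n ρ (A.dual ::ₘ Γ) ∧ Disjoint (seqLoc n Δ) (seqLoc n Γ) := by
  constructor
  · intro h
    cases h with
    | cut _ Δ Γ _ _ h1 h2 h3 => exact ⟨Δ, Γ, rfl, h1, h2, h3⟩
  · rintro ⟨Δ, Γ, rfl, h1, h2, h3⟩
    exact .cut _ _ _ _ _ h1 h2 h3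

theorem derives_tensor_iff :
    Derives n (Tree.tensor A B π ρ) Θ ↔ ∃ Δ Γ, Θ = A.tensor B ::ₘ (Δ + Γ) ∧
      Derives n π (A ::ₘ Δ) ∧ Derives n ρ (B ::ₘ Γ) ∧
      Disjoint (seqLoc n (A ::ₘ Δ)) (seqLoc n (B ::ₘ Γ)) := by
  constructor
  · intro h
    cases h with
    | tensor _ _ Δ Γ _ _ h1 h2 h3 => exact ⟨Δ, Γ, rfl, h1, h2, h3⟩
  · rintro ⟨Δ, Γ, rfl, h1, h2, h3⟩
    exact .tensor _ _ _ _ _ _ h1 h2 h3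

theorem derives_par_iff :
    Derives n (Tree.par A B π) Θ ↔ ∃ Γ, Θ = A.par B ::ₘ Γ ∧ Derives n π (A ::ₘ B ::ₘ Γ) := by
  constructor
  · intro h
    cases h with
    | par _ _ Γ _ h1 => exact ⟨Γ, rfl, h1⟩
  · rintro ⟨Γ, rfl, h1⟩
    exact .par _ _ _ _ h1

theorem derives_one_iff : Derives n Tree.one Θ ↔ Θ = {Formula.one} := by
  constructor
  · rintro ⟨⟩
    rfl
  · rintro rfl
    exact .one

theorem derives_bot_iff :
    Derives n (Tree.bot π) Θ ↔ ∃ Γ, Θ = Formula.bot ::ₘ Γ ∧ Derives n π Γ := by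
  constructor
  · intro h
    cases h with
    | bot Γ _ h1 => exact ⟨Γ, rfl, h1⟩
  · rintro ⟨Γ, rfl, h1⟩
    exact .bot _ _ h1

theorem derives_mix_iff :
    Derives n (Tree.mix π ρ) Θ ↔ ∃ Γ Δ, Θ = Γ + Δ ∧ Derives n π Γ ∧ Derives n ρ Δ ∧
      Disjoint (seqLoc n Γ) (seqLoc n Δ) := by
  constructor
  · intro h
    cases h with
    | mix Γ Δ _ _ h1 h2 h3 => exact ⟨Γ, Δ, rfl, h1, h2, h3⟩
  · rintro ⟨Γ, Δ, rfl, h1, h2, h3⟩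
    exact .mix _ _ _ _ h1 h2 h3

end Inversion

/-- A tree derives at most one sequent. -/
theorem Derives.unique {n : ℕ → ℕ} {π : Tree} {Γ : Multiset Formula} (h : Derives n π Γ) :
    ∀ {Γ'}, Derives n π Γ' → Γ = Γ' := by
  induction h with
  | ax i j k _ =>
    intro Γ' h
    exact (derives_ax_iff.mp h).2.symm
  | cut A Δ Γ π ρ _ _ _ ih1 ih2 =>
    intro Γ' h
    obtain ⟨Δ', Γ', rfl, h1, h2, -⟩ := derives_cut_iff.mp h
    rw [(Multiset.cons_inj_right _).mp (ih1 h1), (Multiset.cons_inj_right _).mp (ih2 h2)]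
  | tensor A B Δ Γ π ρ _ _ _ ih1 ih2 =>
    intro Γ' h
    obtain ⟨Δ', Γ', rfl, h1, h2, -⟩ := derives_tensor_iff.mp h
    rw [(Multiset.cons_inj_right _).mp (ih1 h1), (Multiset.cons_inj_right _).mp (ih2 h2)]
  | par A B Γ π _ ih =>
    intro Γ' h
    obtain ⟨Γ', rfl, h1⟩ := derives_par_iff.mp h
    rw [(Multiset.cons_inj_right _).mp ((Multiset.cons_inj_right _).mp (ih h1))]
  | one =>
    intro Γ' h
    exact (derives_one_iff.mp h).symm
  | bot Γ π _ ih =>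
    intro Γ' h
    obtain ⟨Γ', rfl, h1⟩ := derives_bot_iff.mp h
    rw [ih h1]
  | mix Γ Δ π ρ _ _ _ ih1 ih2 =>
    intro Γ' h
    obtain ⟨Γ', Δ', rfl, h1, h2, -⟩ := derives_mix_iff.mp h
    rw [ih1 h1, ih2 h2]

/-! #### Linearity of the axioms -/

namespace Formula

/-- The variable `X_i(j)`, with `p = (i, j)`, occurs positively. -/
def HasVar (p : ℕ × ℕ) : Formula → Prop
  | var i j => p = (i, j)
  | nvar _ _ => False
  | tensor A B => A.HasVar p ∨ B.HasVar p
  | par A B => A.HasVar p ∨ B.HasVar p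
  | one => False
  | bot => False

/-- The variable `X_i(j)`, with `p = (i, j)`, occurs negatively. -/
def HasNVar (p : ℕ × ℕ) : Formula → Prop
  | var _ _ => False
  | nvar i j => p = (i, j)
  | tensor A B => A.HasNVar p ∨ B.HasNVar p
  | par A B => A.HasNVar p ∨ B.HasNVar p
  | one => False
  | bot => False

theorem hasVar_dual {p : ℕ × ℕ} {A : Formula} : A.dual.HasVar p ↔ A.HasNVar p := by
  induction A <;> simp_all [dual, HasVar, HasNVar]

theorem hasNVar_dual {p : ℕ × ℕ} {A : Formula} : A.dual.HasNVar p ↔ A.HasVar p := by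
  induction A <;> simp_all [dual, HasVar, HasNVar]

theorem exists_var_of_mem_loc {n : ℕ → ℕ} {x : ℕ × ℕ} {A : Formula} (h : x ∈ A.loc n) :
    ∃ p : ℕ × ℕ, (A.HasVar p ∨ A.HasNVar p) ∧ x ∈ varLoc n p.1 p.2 := by
  induction A with
  | var i j => exact ⟨(i, j), .inl rfl, h⟩
  | nvar i j => exact ⟨(i, j), .inr rfl, h⟩
  | tensor A B ih1 ih2 =>
    rcases Finset.mem_union.mp h with h | h
    · obtain ⟨p, hp, hx⟩ := ih1 h
      exact ⟨p, hp.imp .inl .inl, hx⟩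
    · obtain ⟨p, hp, hx⟩ := ih2 h
      exact ⟨p, hp.imp .inr .inr, hx⟩
  | par A B ih1 ih2 =>
    rcases Finset.mem_union.mp h with h | h
    · obtain ⟨p, hp, hx⟩ := ih1 h
      exact ⟨p, hp.imp .inl .inl, hx⟩
    · obtain ⟨p, hp, hx⟩ := ih2 h
      exact ⟨p, hp.imp .inr .inr, hx⟩
  | one => simp [loc] at h
  | bot => simp [loc] at h

end Formula

/-- The first coordinate records the name, and the blocks of one name are pairwise disjoint: a
location determines its variable. -/
theorem varLoc_inj {n : ℕ → ℕ} {x p q : ℕ × ℕ} (hp : x ∈ varLoc n p.1 p.2)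
    (hq : x ∈ varLoc n q.1 q.2) : p = q := by
  obtain ⟨i, j⟩ := p
  obtain ⟨i', j'⟩ := q
  have h1 := (Finset.mem_product.mp hp).1
  have h2 := (Finset.mem_product.mp hq).1
  rw [Finset.mem_singleton] at h1 h2
  simp only at h1 h2 hp hq
  subst h1 h2
  by_contra h
  exact Finset.disjoint_left.mp (varLoc_disjoint n _ j j' fun e => h (by rw [e])) hp hq

theorem exists_mem_of_mem_seqLoc {n : ℕ → ℕ} {x : ℕ × ℕ} {Γ : Multiset Formula}
    (h : x ∈ seqLoc n Γ) : ∃ A ∈ Γ, x ∈ A.loc n := by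
  induction Γ using Multiset.induction_on with
  | empty => simp [seqLoc] at h
  | cons A Γ ih =>
    rw [seqLoc_cons, Finset.mem_union] at h
    rcases h with h | h
    · exact ⟨A, Multiset.mem_cons_self _ _, h⟩
    · obtain ⟨B, hB, h⟩ := ih h
      exact ⟨B, Multiset.mem_cons_of_mem hB, h⟩

/-- Atoms enter a derivation through axioms only. -/
theorem Derives.mem_axVars {n : ℕ → ℕ} {π : Tree} {Γ : Multiset Formula} (h : Derives n π Γ)
    {p : ℕ × ℕ} : ∀ A ∈ Γ, A.HasVar p → p ∈ π.axVars := by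
  induction h <;>
    simp_all [Tree.axVars, Formula.HasVar] <;> grind

theorem Derives.mem_axNVars {n : ℕ → ℕ} {π : Tree} {Γ : Multiset Formula} (h : Derives n π Γ)
    {p : ℕ × ℕ} : ∀ A ∈ Γ, A.HasNVar p → p ∈ π.axNVars := by
  induction h <;>
    simp_all [Tree.axNVars, Formula.HasNVar] <;> grind

/-- A formula cut between two derivations is located apart from the conclusion of a third one, when
the three of them use different axioms. -/
theorem disjoint_loc_of_linear {n : ℕ → ℕ} {B : Formula} {π₁ π₂ ρ : Tree}
    {Γ₁ Γ₂ Θ : Multiset Formula} (h1 : Derives n π₁ Γ₁) (hB1 : B ∈ Γ₁)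
    (h2 : Derives n π₂ Γ₂) (hB2 : B.dual ∈ Γ₂) (h3 : Derives n ρ Θ)
    (hv : (π₁.axVars + π₂.axVars + ρ.axVars).Nodup)
    (hn : (π₁.axNVars + π₂.axNVars + ρ.axNVars).Nodup) :
    Disjoint (B.loc n) (seqLoc n Θ) := by
  refine Finset.disjoint_left.mpr fun x hx hx' => ?_
  obtain ⟨C, hC, hx'⟩ := exists_mem_of_mem_seqLoc hx'
  obtain ⟨p, hp, hxp⟩ := Formula.exists_var_of_mem_loc hx
  obtain ⟨q, hq, hxq⟩ := Formula.exists_var_of_mem_loc hx'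
  obtain rfl := varLoc_inj hxp hxq
  replace hv : p ∈ _ → p ∉ _ := fun h => Multiset.disjoint_left.mp (Multiset.nodup_add.mp hv).2.2 h
  replace hn : p ∈ _ → p ∉ _ := fun h => Multiset.disjoint_left.mp (Multiset.nodup_add.mp hn).2.2 h
  rw [Multiset.mem_add] at hv hn
  -- Since `B` and its dual occur in the first two conclusions, the variable `p` is introduced there
  -- with both polarities. No axiom of `ρ` can then introduce it with either one.
  have hvp := hv (hp.elim (fun h => .inl (h1.mem_axVars B hB1 h))
    fun h => .inr (h2.mem_axVars _ hB2 (Formula.hasVar_dual.mpr h)))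
  have hnp := hn (hp.elim (fun h => .inr (h2.mem_axNVars _ hB2 (Formula.hasNVar_dual.mpr h)))
    fun h => .inl (h1.mem_axNVars B hB1 h))
  exact hq.elim (fun h => hvp (h3.mem_axVars C hC h)) fun h => hnp (h3.mem_axNVars C hC h)

/-! #### Steps -/

theorem Derives.cast {n : ℕ → ℕ} {π : Tree} {Γ Γ' : Multiset Formula} (h : Derives n π Γ)
    (e : Γ = Γ') : Derives n π Γ' := e ▸ h

theorem den_cut {n : ℕ → ℕ} {A : Formula} {π ρ : Tree} :
    den n (Tree.cut A π ρ) = (den n π).bind fun a => (den n ρ).bind fun b => a.cut b := rfl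

theorem isProof_cut_symm {n : ℕ → ℕ} {A : Formula} {π ρ : Tree} {Γ : Multiset Formula}
    (h : IsProof n (Tree.cut A π ρ) Γ) : IsProof n (Tree.cut A.dual ρ π) Γ := by
  obtain ⟨h, hv, hn⟩ := h
  obtain ⟨Δ, Γ, rfl, h1, h2, h3⟩ := derives_cut_iff.mp h
  refine ⟨derives_cut_iff.mpr ⟨Γ, Δ, add_comm _ _, h2, ?_, h3.symm⟩, ?_, ?_⟩
  · rwa [Formula.dual_dual]
  · simpa only [Tree.axVars, add_comm] using hv
  · simpa only [Tree.axNVars, add_comm] using hn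

theorem den_cut_symm {n : ℕ → ℕ} {A B : Formula} {π ρ : Tree} :
    den n (Tree.cut A π ρ) = den n (Tree.cut B ρ π) := by
  simp only [den_cut]
  cases den n π <;> cases den n ρ <;> simp [Den.cut_comm]

/-- Equality except in the axiom step, where the cut atom disappears; hence linearity is inherited
by reducts. -/
theorem CutStep.axVars_le {n : ℕ → ℕ} {A : Formula} {π ρ τ : Tree} (h : CutStep n A π ρ τ) :
    τ.axVars ≤ π.axVars + ρ.axVars := by
  cases h <;> simp only [Tree.axVars]
  case ax_ax => exact Multiset.le_add_left _ _
  case one_bot => exact Multiset.le_add_left _ _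
  all_goals exact le_of_eq (by ac_rfl)

theorem CutStep.axNVars_le {n : ℕ → ℕ} {A : Formula} {π ρ τ : Tree} (h : CutStep n A π ρ τ) :
    τ.axNVars ≤ π.axNVars + ρ.axNVars := by
  cases h <;> simp only [Tree.axNVars]
  case ax_ax => exact Multiset.le_add_right _ _
  case one_bot => exact Multiset.le_add_left _ _
  all_goals exact le_of_eq (by ac_rfl)


/-! ### Each cut step preserves the sequent and the denotation. -/

section CutStep

variable {n : ℕ → ℕ} {Θ : Multiset Formula}

/-- Inversion of a cut with the left context prescribed, which uniqueness of the derived sequent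
allows. This matters because a commutation step carries its own derivation of the premise. -/
theorem cut_inv {A : Formula} {Δ : Multiset Formula} {π ρ : Tree}
    (h : Derives n (Tree.cut A π ρ) Θ) (hπ : Derives n π (A ::ₘ Δ)) :
    ∃ Γ, Θ = Δ + Γ ∧ Derives n ρ (A.dual ::ₘ Γ) ∧ Disjoint (seqLoc n Δ) (seqLoc n Γ) := by
  obtain ⟨Δ', Γ, rfl, h1, h2, h3⟩ := derives_cut_iff.mp h
  obtain rfl := (Multiset.cons_inj_right _).mp (h1.unique hπ)
  exact ⟨Γ, rfl, h2, h3⟩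

theorem sound_ax_ax {i j k l : ℕ} (hjl : j ≠ l)
    (h : Derives n (Tree.cut (Formula.var i k) (Tree.ax i j k) (Tree.ax i k l)) Θ) :
    Derives n (Tree.ax i j l) Θ ∧
      den n (Tree.cut (Formula.var i k) (Tree.ax i j k) (Tree.ax i k l)) =
        den n (Tree.ax i j l) := by
  obtain ⟨Δ, Γ, rfl, h1, h2, -⟩ := derives_cut_iff.mp h
  obtain ⟨hjk, h1⟩ := derives_ax_iff.mp h1
  obtain ⟨hkl, h2⟩ := derives_ax_iff.mp h2
  obtain rfl : Δ = {Formula.nvar i j} :=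
    (Multiset.cons_inj_right _).mp (h1.trans (Multiset.cons_swap _ _ 0))
  obtain rfl : Γ = {Formula.var i l} := (Multiset.cons_inj_right _).mp h2
  exact ⟨.ax _ _ _ hjl, axDen_cut hjk hkl hjl⟩

theorem sound_tensor_par {A B : Formula} {π₁ π₂ π₃ : Tree}
    (h : Derives n (Tree.cut (A.tensor B) (Tree.tensor A B π₁ π₂)
      (Tree.par A.dual B.dual π₃)) Θ) :
    Derives n (Tree.cut B π₂ (Tree.cut A π₁ π₃)) Θ ∧
      den n (Tree.cut (A.tensor B) (Tree.tensor A B π₁ π₂) (Tree.par A.dual B.dual π₃)) =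
        den n (Tree.cut B π₂ (Tree.cut A π₁ π₃)) := by
  obtain ⟨Δ, Γ, rfl, h1, h2, h3⟩ := derives_cut_iff.mp h
  obtain ⟨Δ₁, Δ₂, e, h4, h5, h6⟩ := derives_tensor_iff.mp h1
  obtain ⟨Γ, e', h7⟩ := derives_par_iff.mp h2
  obtain rfl := (Multiset.cons_inj_right _).mp e
  obtain rfl := (Multiset.cons_inj_right _).mp e'
  constructor
  · simp only [seqLoc_cons, seqLoc_add, Finset.disjoint_union_left,
      Finset.disjoint_union_right] at h3 h6
    have h8 : Derives n (Tree.cut A π₁ π₃) (B.dual ::ₘ (Δ₁ + Γ)) := by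
      refine (Derives.cut _ _ _ _ _ h4 h7 ?_).cast (Multiset.add_cons _ _ _)
      simp only [seqLoc_cons, Finset.disjoint_union_right, Formula.loc_dual]
      exact ⟨h6.1.2, h3.1⟩
    refine (Derives.cut _ _ _ _ _ h5 h8 ?_).cast (by ac_rfl)
    simp only [seqLoc_add, Finset.disjoint_union_right]
    exact ⟨h6.2.2.symm, h3.2⟩
  · simp only [den]
    -- The carriers are known only for defined denotations; if one is undefined, so are both sides.
    rcases h8 : den n π₁ with _ | a
    · cases den n π₂ <;> simp
    rcases h9 : den n π₂ with _ | b
    · simp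
    rw [← den_V h4 h8, ← den_V h5 h9] at h6
    cases den n π₃ <;> simp [Den.cut_union h6]

theorem sound_one_bot {π : Tree}
    (h : Derives n (Tree.cut Formula.one Tree.one (Tree.bot π)) Θ) :
    Derives n π Θ ∧ den n (Tree.cut Formula.one Tree.one (Tree.bot π)) = den n π := by
  obtain ⟨Δ, Γ, rfl, h1, h2, h3⟩ := derives_cut_iff.mp h
  obtain ⟨Γ', e', h7⟩ := derives_bot_iff.mp h2
  obtain rfl := (Multiset.cons_inj_right _).mp e'
  obtain rfl : Δ = 0 := (Multiset.cons_inj_right _).mp (derives_one_iff.mp h1)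
  refine ⟨by simpa using h7, ?_⟩
  simp only [den, Option.bind_some, Den.empty_cut]
  cases den n π <;> rfl

theorem sound_comm_par {A B C : Formula} {Δ : Multiset Formula} {π ρ : Tree}
    (hA : Derives n π (B ::ₘ C ::ₘ A ::ₘ Δ)) (h : Derives n (Tree.cut A (Tree.par B C π) ρ) Θ) :
    Derives n (Tree.par B C (Tree.cut A π ρ)) Θ ∧
      den n (Tree.cut A (Tree.par B C π) ρ) = den n (Tree.par B C (Tree.cut A π ρ)) := by
  refine ⟨?_, rfl⟩
  obtain ⟨Γ, rfl, h2, h3⟩ := cut_inv h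
    ((Derives.par _ _ _ _ hA).cast (Multiset.cons_swap _ _ _))
  have h4 : Derives n π (A ::ₘ B ::ₘ C ::ₘ Δ) := hA.cast (by
    simp only [← Multiset.singleton_add]; ac_rfl)
  refine (Derives.par _ _ (Δ + Γ) _ ((Derives.cut _ _ _ _ _ h4 h2 ?_).cast ?_)).cast ?_
  · simpa only [seqLoc_cons, Formula.loc, Finset.union_assoc] using h3
  · simp only [Multiset.cons_add]
  · simp only [Multiset.cons_add]

theorem sound_comm_bot {A : Formula} {Δ : Multiset Formula} {π ρ : Tree}
    (hA : Derives n π (A ::ₘ Δ)) (h : Derives n (Tree.cut A (Tree.bot π) ρ) Θ) :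
    Derives n (Tree.bot (Tree.cut A π ρ)) Θ ∧
      den n (Tree.cut A (Tree.bot π) ρ) = den n (Tree.bot (Tree.cut A π ρ)) := by
  refine ⟨?_, rfl⟩
  obtain ⟨Γ, rfl, h2, h3⟩ := cut_inv h
    ((Derives.bot _ _ hA).cast (Multiset.cons_swap _ _ _))
  refine (Derives.bot _ _ (Derives.cut _ _ _ _ _ hA h2 ?_)).cast ?_
  · simpa only [seqLoc_cons, Formula.loc, Finset.empty_union] using h3
  · simp only [Multiset.cons_add]

/-- Lifts the law to partial denotations: an undefined argument makes both sides undefined, so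
disjointness is required of defined ones only. -/
theorem den_cut_union_left {o p q : Option (Den (ℕ × ℕ))}
    (h : ∀ a ∈ o, ∀ b ∈ p, ∀ c ∈ q, Disjoint a.V b.V ∧ Disjoint b.V c.V) :
    ((o.bind fun a => p.bind fun b => some (a.union b)).bind fun a => q.bind fun b => a.cut b) =
      (o.bind fun a => q.bind fun b => a.cut b).bind fun a =>
        p.bind fun b => some (a.union b) := by
  rcases o with _ | a
  · simp
  rcases p with _ | b
  · simp
  rcases q with _ | c
  · simp
  obtain ⟨h1, h2⟩ := h a rfl b rfl c rfl
  simpa using Den.cut_union_left h1 h2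

theorem den_cut_union_right {o p q : Option (Den (ℕ × ℕ))}
    (h : ∀ a ∈ o, ∀ b ∈ p, ∀ c ∈ q, Disjoint a.V b.V ∧ Disjoint a.V c.V) :
    ((o.bind fun a => p.bind fun b => some (a.union b)).bind fun a => q.bind fun b => a.cut b) =
      o.bind fun a => (p.bind fun b => q.bind fun c => b.cut c).bind fun b =>
        some (a.union b) := by
  rcases o with _ | a
  · simp
  rcases p with _ | b
  · simp
  rcases q with _ | c
  · simp
  obtain ⟨h1, h2⟩ := h a rfl b rfl c rfl
  simpa using Den.cut_union_right h1 h2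

theorem den_cut_cut_left {o p q : Option (Den (ℕ × ℕ))}
    (h : ∀ b ∈ p, ∀ c ∈ q, Disjoint b.V c.V) :
    ((o.bind fun a => p.bind fun b => a.cut b).bind fun a => q.bind fun b => a.cut b) =
      (o.bind fun a => q.bind fun b => a.cut b).bind fun a => p.bind fun b => a.cut b := by
  rcases o with _ | a
  · simp
  rcases p with _ | b
  · simp
  rcases q with _ | c
  · simp
  simpa using Den.cut_cut_left (h b rfl c rfl)

theorem den_cut_cut_right {o p q : Option (Den (ℕ × ℕ))}
    (h : ∀ a ∈ o, ∀ c ∈ q, Disjoint a.V c.V) :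
    ((o.bind fun a => p.bind fun b => a.cut b).bind fun a => q.bind fun b => a.cut b) =
      o.bind fun a => (p.bind fun b => q.bind fun c => b.cut c).bind fun b => a.cut b := by
  rcases o with _ | a
  · simp
  rcases p with _ | b
  · simp
  rcases q with _ | c
  · simp
  simpa using Den.cut_cut_right (h a rfl c rfl)

theorem sound_comm_tensor_left {A B C : Formula} {Δ : Multiset Formula} {π₁ π₂ ρ : Tree}
    (hA : Derives n π₁ (B ::ₘ A ::ₘ Δ))
    (h : Derives n (Tree.cut A (Tree.tensor B C π₁ π₂) ρ) Θ) :
    Derives n (Tree.tensor B C (Tree.cut A π₁ ρ) π₂) Θ ∧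
      den n (Tree.cut A (Tree.tensor B C π₁ π₂) ρ) =
        den n (Tree.tensor B C (Tree.cut A π₁ ρ) π₂) := by
  obtain ⟨_, _, -, h1, -, -⟩ := derives_cut_iff.mp h
  obtain ⟨Δ₁, Δ₂, -, h4, h5, h6⟩ := derives_tensor_iff.mp h1
  obtain rfl := (Multiset.cons_inj_right _).mp (h4.unique hA)
  obtain ⟨Γ, rfl, h2, h3⟩ := cut_inv (Δ := B.tensor C ::ₘ (Δ + Δ₂)) h
    ((Derives.tensor _ _ _ _ _ _ h4 h5 h6).cast (by
      simp only [← Multiset.singleton_add]; ac_rfl))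
  have h7 := h6
  simp only [seqLoc_cons, seqLoc_add, Formula.loc, Finset.disjoint_union_left,
    Finset.disjoint_union_right] at h3 h6
  constructor
  · have h8 : Derives n (Tree.cut A π₁ ρ) (B ::ₘ (Δ + Γ)) := by
      refine (Derives.cut _ _ _ _ _ (h4.cast (Multiset.cons_swap _ _ _)) h2 ?_).cast
        (Multiset.cons_add _ _ _)
      simp only [seqLoc_cons, Finset.disjoint_union_left]
      tauto
    refine (Derives.tensor _ _ _ _ _ _ h8 h5 ?_).cast (by
      simp only [← Multiset.singleton_add]; ac_rfl)
    simp only [seqLoc_cons, seqLoc_add, Finset.disjoint_union_left,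
      Finset.disjoint_union_right]
    have := h3.1.2.symm
    have := h3.2.2.symm
    tauto
  · refine den_cut_union_left fun a ha b hb c hc => ?_
    rw [den_V h4 ha, den_V h5 hb, den_V h2 hc]
    refine ⟨h7, ?_⟩
    simp only [seqLoc_cons, Formula.loc_dual, Finset.disjoint_union_left,
      Finset.disjoint_union_right]
    have := h6.1.2.1.symm
    have := h6.2.2.1.symm
    tauto

theorem sound_comm_tensor_right {A B C : Formula} {Δ : Multiset Formula} {π₁ π₂ ρ : Tree}
    (hA : Derives n π₂ (C ::ₘ A ::ₘ Δ))
    (h : Derives n (Tree.cut A (Tree.tensor B C π₁ π₂) ρ) Θ) :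
    Derives n (Tree.tensor B C π₁ (Tree.cut A π₂ ρ)) Θ ∧
      den n (Tree.cut A (Tree.tensor B C π₁ π₂) ρ) =
        den n (Tree.tensor B C π₁ (Tree.cut A π₂ ρ)) := by
  obtain ⟨_, _, -, h1, -, -⟩ := derives_cut_iff.mp h
  obtain ⟨Δ₁, Δ₂, -, h4, h5, h6⟩ := derives_tensor_iff.mp h1
  obtain rfl := (Multiset.cons_inj_right _).mp (h5.unique hA)
  obtain ⟨Γ, rfl, h2, h3⟩ := cut_inv (Δ := B.tensor C ::ₘ (Δ₁ + Δ)) h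
    ((Derives.tensor _ _ _ _ _ _ h4 h5 h6).cast (by
      simp only [← Multiset.singleton_add]; ac_rfl))
  have h7 := h6
  simp only [seqLoc_cons, seqLoc_add, Formula.loc, Finset.disjoint_union_left,
    Finset.disjoint_union_right] at h3 h6
  constructor
  · have h8 : Derives n (Tree.cut A π₂ ρ) (C ::ₘ (Δ + Γ)) := by
      refine (Derives.cut _ _ _ _ _ (h5.cast (Multiset.cons_swap _ _ _)) h2 ?_).cast
        (Multiset.cons_add _ _ _)
      simp only [seqLoc_cons, Finset.disjoint_union_left]
      tauto
    refine (Derives.tensor _ _ _ _ _ _ h4 h8 ?_).cast (by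
      simp only [← Multiset.singleton_add]; ac_rfl)
    simp only [seqLoc_cons, seqLoc_add, Finset.disjoint_union_left,
      Finset.disjoint_union_right]
    tauto
  · refine den_cut_union_right fun a ha b hb c hc => ?_
    rw [den_V h4 ha, den_V h5 hb, den_V h2 hc]
    refine ⟨h7, ?_⟩
    simp only [seqLoc_cons, Formula.loc_dual, Finset.disjoint_union_left,
      Finset.disjoint_union_right]
    tauto

theorem sound_comm_mix_left {A : Formula} {Δ : Multiset Formula} {π₁ π₂ ρ : Tree}
    (hA : Derives n π₁ (A ::ₘ Δ)) (h : Derives n (Tree.cut A (Tree.mix π₁ π₂) ρ) Θ) :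
    Derives n (Tree.mix (Tree.cut A π₁ ρ) π₂) Θ ∧
      den n (Tree.cut A (Tree.mix π₁ π₂) ρ) = den n (Tree.mix (Tree.cut A π₁ ρ) π₂) := by
  obtain ⟨_, _, -, h1, -, -⟩ := derives_cut_iff.mp h
  obtain ⟨Δ₁, Δ₂, -, h4, h5, h6⟩ := derives_mix_iff.mp h1
  obtain rfl := h4.unique hA
  obtain ⟨Γ, rfl, h2, h3⟩ := cut_inv (Δ := Δ + Δ₂) h
    ((Derives.mix _ _ _ _ h4 h5 h6).cast (Multiset.cons_add _ _ _))
  have h7 := h6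
  simp only [seqLoc_cons, seqLoc_add, Finset.disjoint_union_left] at h3 h6
  constructor
  · refine (Derives.mix _ _ _ _ (Derives.cut _ _ _ _ _ h4 h2 h3.1) h5 ?_).cast (by ac_rfl)
    simp only [seqLoc_add, Finset.disjoint_union_left]
    exact ⟨h6.2, h3.2.symm⟩
  · refine den_cut_union_left fun a ha b hb c hc => ?_
    rw [den_V h4 ha, den_V h5 hb, den_V h2 hc]
    refine ⟨h7, ?_⟩
    simp only [seqLoc_cons, Formula.loc_dual, Finset.disjoint_union_right]
    exact ⟨h6.1.symm, h3.2⟩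

theorem sound_comm_mix_right {A : Formula} {Δ : Multiset Formula} {π₁ π₂ ρ : Tree}
    (hA : Derives n π₂ (A ::ₘ Δ)) (h : Derives n (Tree.cut A (Tree.mix π₁ π₂) ρ) Θ) :
    Derives n (Tree.mix π₁ (Tree.cut A π₂ ρ)) Θ ∧
      den n (Tree.cut A (Tree.mix π₁ π₂) ρ) = den n (Tree.mix π₁ (Tree.cut A π₂ ρ)) := by
  obtain ⟨_, _, -, h1, -, -⟩ := derives_cut_iff.mp h
  obtain ⟨Δ₁, Δ₂, -, h4, h5, h6⟩ := derives_mix_iff.mp h1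
  obtain rfl := h5.unique hA
  obtain ⟨Γ, rfl, h2, h3⟩ := cut_inv (Δ := Δ₁ + Δ) h
    ((Derives.mix _ _ _ _ h4 h5 h6).cast (Multiset.add_cons _ _ _))
  have h7 := h6
  simp only [seqLoc_cons, seqLoc_add, Finset.disjoint_union_left,
    Finset.disjoint_union_right] at h3 h6
  constructor
  · refine (Derives.mix _ _ _ _ h4 (Derives.cut _ _ _ _ _ h5 h2 h3.2) ?_).cast (by ac_rfl)
    simp only [seqLoc_add, Finset.disjoint_union_right]
    exact ⟨h6.2, h3.1⟩
  · refine den_cut_union_right fun a ha b hb c hc => ?_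
    rw [den_V h4 ha, den_V h5 hb, den_V h2 hc]
    refine ⟨h7, ?_⟩
    simp only [seqLoc_cons, Formula.loc_dual, Finset.disjoint_union_right]
    exact ⟨h6.1, h3.1⟩

theorem sound_comm_cut_left {A B : Formula} {Δ : Multiset Formula} {π₁ π₂ ρ : Tree}
    (hA : Derives n π₁ (B ::ₘ A ::ₘ Δ)) (h : IsProof n (Tree.cut A (Tree.cut B π₁ π₂) ρ) Θ) :
    Derives n (Tree.cut B (Tree.cut A π₁ ρ) π₂) Θ ∧
      den n (Tree.cut A (Tree.cut B π₁ π₂) ρ) = den n (Tree.cut B (Tree.cut A π₁ ρ) π₂) := by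
  obtain ⟨h, hv, hn⟩ := h
  obtain ⟨_, _, -, h1, -, -⟩ := derives_cut_iff.mp h
  obtain ⟨Δ₁, Δ₂, -, h4, h5, h6⟩ := derives_cut_iff.mp h1
  obtain rfl := (Multiset.cons_inj_right _).mp (h4.unique hA)
  obtain ⟨Γ, rfl, h2, h3⟩ := cut_inv (Δ := Δ + Δ₂) h
    ((Derives.cut _ _ _ _ _ h4 h5 h6).cast (Multiset.cons_add _ _ _))
  -- The cut formula `B` has left the conclusion, so the side conditions do not separate it from the
  -- conclusion of `ρ`; linearity of the axioms does.
  have h7 := disjoint_loc_of_linear h4 (Multiset.mem_cons_self _ _) h5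
    (Multiset.mem_cons_self _ _) h2 hv hn
  have h8 := (isSequent_cons.mp h4.isSequent).2.1
  simp only [seqLoc_cons, seqLoc_add, Formula.loc_dual, Finset.disjoint_union_left,
    Finset.disjoint_union_right] at h3 h6 h7 h8
  constructor
  · have h9 : Derives n (Tree.cut A π₁ ρ) (B ::ₘ (Δ + Γ)) := by
      refine (Derives.cut _ _ _ _ _ (h4.cast (Multiset.cons_swap _ _ _)) h2 ?_).cast
        (Multiset.cons_add _ _ _)
      simp only [seqLoc_cons, Finset.disjoint_union_left]
      exact ⟨h7.2, h3.1⟩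
    refine (Derives.cut _ _ _ _ _ h9 h5 ?_).cast (by ac_rfl)
    simp only [seqLoc_add, Finset.disjoint_union_left]
    exact ⟨h6.2, h3.2.symm⟩
  · refine den_cut_cut_left fun b hb c hc => ?_
    rw [den_V h5 hb, den_V h2 hc]
    simp only [seqLoc_cons, Formula.loc_dual, Finset.disjoint_union_left,
      Finset.disjoint_union_right]
    exact ⟨⟨h7.1, h6.1.symm⟩, h7.2, h3.2⟩

theorem sound_comm_cut_right {A B : Formula} {Δ : Multiset Formula} {π₁ π₂ ρ : Tree}
    (hA : Derives n π₂ (B.dual ::ₘ A ::ₘ Δ))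
    (h : IsProof n (Tree.cut A (Tree.cut B π₁ π₂) ρ) Θ) :
    Derives n (Tree.cut B π₁ (Tree.cut A π₂ ρ)) Θ ∧
      den n (Tree.cut A (Tree.cut B π₁ π₂) ρ) = den n (Tree.cut B π₁ (Tree.cut A π₂ ρ)) := by
  obtain ⟨h, hv, hn⟩ := h
  obtain ⟨_, _, -, h1, -, -⟩ := derives_cut_iff.mp h
  obtain ⟨Δ₁, Δ₂, -, h4, h5, h6⟩ := derives_cut_iff.mp h1
  obtain rfl := (Multiset.cons_inj_right _).mp (h5.unique hA)
  obtain ⟨Γ, rfl, h2, h3⟩ := cut_inv (Δ := Δ₁ + Δ) h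
    ((Derives.cut _ _ _ _ _ h4 h5 h6).cast (Multiset.add_cons _ _ _))
  have h7 := disjoint_loc_of_linear h4 (Multiset.mem_cons_self _ _) h5
    (Multiset.mem_cons_self _ _) h2 hv hn
  simp only [seqLoc_cons, seqLoc_add, Formula.loc_dual, Finset.disjoint_union_left,
    Finset.disjoint_union_right] at h3 h6 h7
  constructor
  · have h9 : Derives n (Tree.cut A π₂ ρ) (B.dual ::ₘ (Δ + Γ)) := by
      refine (Derives.cut _ _ _ _ _ (h5.cast (Multiset.cons_swap _ _ _)) h2 ?_).cast
        (Multiset.cons_add _ _ _)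
      simp only [seqLoc_cons, Formula.loc_dual, Finset.disjoint_union_left]
      exact ⟨h7.2, h3.2⟩
    refine (Derives.cut _ _ _ _ _ h4 h9 ?_).cast (by ac_rfl)
    simp only [seqLoc_add, Finset.disjoint_union_right]
    exact ⟨h6.2, h3.1⟩
  · refine den_cut_cut_right fun b hb c hc => ?_
    rw [den_V h4 hb, den_V h2 hc]
    simp only [seqLoc_cons, Formula.loc_dual, Finset.disjoint_union_left,
      Finset.disjoint_union_right]
    exact ⟨⟨h7.1, h6.1⟩, h7.2, h3.1⟩

theorem CutStep.sound {A : Formula} {π ρ τ : Tree} (h : CutStep n A π ρ τ)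
    (hp : IsProof n (Tree.cut A π ρ) Θ) :
    IsProof n τ Θ ∧ den n (Tree.cut A π ρ) = den n τ := by
  -- Linearity of `τ` follows from the inclusion of its axioms, whichever the step.
  suffices Derives n τ Θ ∧ den n (Tree.cut A π ρ) = den n τ from
    ⟨⟨this.1, Multiset.nodup_of_le h.axVars_le hp.2.1,
      Multiset.nodup_of_le h.axNVars_le hp.2.2⟩, this.2⟩
  cases h with
  | ax_ax i j k l hjl => exact sound_ax_ax hjl hp.1
  | tensor_par A B π₁ π₂ π₃ => exact sound_tensor_par hp.1
  | one_bot π => exact sound_one_bot hp.1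
  | comm_par A B C Δ π ρ hA => exact sound_comm_par hA hp.1
  | comm_tensor_left A B C Δ π₁ π₂ ρ hA => exact sound_comm_tensor_left hA hp.1
  | comm_tensor_right A B C Δ π₁ π₂ ρ hA => exact sound_comm_tensor_right hA hp.1
  | comm_bot A Δ π ρ hA => exact sound_comm_bot hA hp.1
  | comm_mix_left A Δ π₁ π₂ ρ hA => exact sound_comm_mix_left hA hp.1
  | comm_mix_right A Δ π₁ π₂ ρ hA => exact sound_comm_mix_right hA hp.1
  | comm_cut_left A B Δ π₁ π₂ ρ hA => exact sound_comm_cut_left hA hp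
  | comm_cut_right A B Δ π₁ π₂ ρ hA => exact sound_comm_cut_right hA hp

end CutStep


/-! ### Steps in context. -/

section

variable {n : ℕ → ℕ}

theorem IsProof.cut_left {A : Formula} {π ρ : Tree} {Θ : Multiset Formula}
    (h : IsProof n (Tree.cut A π ρ) Θ) : ∃ Γ, IsProof n π Γ := by
  obtain ⟨h, hv, hn⟩ := h
  obtain ⟨_, _, -, h1, -, -⟩ := derives_cut_iff.mp h
  exact ⟨_, h1, (Multiset.nodup_add.mp hv).1, (Multiset.nodup_add.mp hn).1⟩

theorem IsProof.cut_right {A : Formula} {π ρ : Tree} {Θ : Multiset Formula}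
    (h : IsProof n (Tree.cut A π ρ) Θ) : ∃ Γ, IsProof n ρ Γ :=
  (isProof_cut_symm h).cut_left

theorem IsProof.tensor_left {A B : Formula} {π ρ : Tree} {Θ : Multiset Formula}
    (h : IsProof n (Tree.tensor A B π ρ) Θ) : ∃ Γ, IsProof n π Γ := by
  obtain ⟨h, hv, hn⟩ := h
  obtain ⟨_, _, -, h1, -, -⟩ := derives_tensor_iff.mp h
  exact ⟨_, h1, (Multiset.nodup_add.mp hv).1, (Multiset.nodup_add.mp hn).1⟩

theorem IsProof.tensor_right {A B : Formula} {π ρ : Tree} {Θ : Multiset Formula}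
    (h : IsProof n (Tree.tensor A B π ρ) Θ) : ∃ Γ, IsProof n ρ Γ := by
  obtain ⟨h, hv, hn⟩ := h
  obtain ⟨_, _, -, -, h1, -⟩ := derives_tensor_iff.mp h
  exact ⟨_, h1, (Multiset.nodup_add.mp hv).2.1, (Multiset.nodup_add.mp hn).2.1⟩

theorem IsProof.of_par {A B : Formula} {π : Tree} {Θ : Multiset Formula}
    (h : IsProof n (Tree.par A B π) Θ) : ∃ Γ, IsProof n π Γ := by
  obtain ⟨h, hv, hn⟩ := h
  obtain ⟨_, -, h1⟩ := derives_par_iff.mp h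
  exact ⟨_, h1, hv, hn⟩

theorem IsProof.of_bot {π : Tree} {Θ : Multiset Formula}
    (h : IsProof n (Tree.bot π) Θ) : ∃ Γ, IsProof n π Γ := by
  obtain ⟨h, hv, hn⟩ := h
  obtain ⟨_, -, h1⟩ := derives_bot_iff.mp h
  exact ⟨_, h1, hv, hn⟩

theorem IsProof.mix_left {π ρ : Tree} {Θ : Multiset Formula}
    (h : IsProof n (Tree.mix π ρ) Θ) : ∃ Γ, IsProof n π Γ := by
  obtain ⟨h, hv, hn⟩ := h
  obtain ⟨_, _, -, h1, -, -⟩ := derives_mix_iff.mp h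
  exact ⟨_, h1, (Multiset.nodup_add.mp hv).1, (Multiset.nodup_add.mp hn).1⟩

theorem IsProof.mix_right {π ρ : Tree} {Θ : Multiset Formula}
    (h : IsProof n (Tree.mix π ρ) Θ) : ∃ Γ, IsProof n ρ Γ := by
  obtain ⟨h, hv, hn⟩ := h
  obtain ⟨_, _, -, -, h1, -⟩ := derives_mix_iff.mp h
  exact ⟨_, h1, (Multiset.nodup_add.mp hv).2.1, (Multiset.nodup_add.mp hn).2.1⟩

/-- The axioms of the reduct of a step are among those of the redex, with multiplicity. -/
theorem Step.axVars_le {π τ : Tree} (h : Step n π τ) :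
    τ.axVars ≤ π.axVars ∧ τ.axNVars ≤ π.axNVars := by
  induction h with
  | cut A π ρ τ h => exact ⟨h.axVars_le, h.axNVars_le⟩
  | cut_symm A π ρ τ h =>
    exact ⟨h.axVars_le.trans_eq (add_comm _ _), h.axNVars_le.trans_eq (add_comm _ _)⟩
  | in_cut_left A π τ ρ _ ih | in_tensor_left A B π τ ρ _ ih | in_mix_left π τ ρ _ ih =>
    exact ⟨add_le_add_left ih.1 _, add_le_add_left ih.2 _⟩
  | in_cut_right A π ρ τ _ ih | in_tensor_right A B π ρ τ _ ih | in_mix_right π ρ τ _ ih =>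
    exact ⟨add_le_add_right ih.1 _, add_le_add_right ih.2 _⟩
  | in_par A B π τ _ ih | in_bot π τ _ ih => exact ih

/-- A step of cut elimination turns a proof into a proof of the same sequent with the same
denotation. -/
theorem Step.sound {π τ : Tree} {Γ : Multiset Formula} (h : Step n π τ) (hp : IsProof n π Γ) :
    IsProof n τ Γ ∧ den n π = den n τ := by
  suffices Derives n τ Γ ∧ den n π = den n τ from
    ⟨⟨this.1, Multiset.nodup_of_le h.axVars_le.1 hp.2.1,
      Multiset.nodup_of_le h.axVars_le.2 hp.2.2⟩, this.2⟩
  obtain ⟨hd, hv, hn⟩ := hp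
  induction h generalizing Γ with
  | cut A π ρ τ h => exact (h.sound ⟨hd, hv, hn⟩).imp_left And.left
  | cut_symm A π ρ τ h =>
    obtain ⟨h1, h2⟩ := h.sound (isProof_cut_symm ⟨hd, hv, hn⟩)
    exact ⟨h1.1, den_cut_symm.trans h2⟩
  | in_cut_left A π τ ρ _ ih =>
    obtain ⟨Δ, Γ, rfl, h1, h2, h3⟩ := derives_cut_iff.mp hd
    obtain ⟨h4, h5⟩ := ih h1 (Multiset.nodup_add.mp hv).1 (Multiset.nodup_add.mp hn).1
    exact ⟨.cut _ _ _ _ _ h4 h2 h3, by simp only [den, h5]⟩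
  | in_cut_right A π ρ τ _ ih =>
    obtain ⟨Δ, Γ, rfl, h1, h2, h3⟩ := derives_cut_iff.mp hd
    obtain ⟨h4, h5⟩ := ih h2 (Multiset.nodup_add.mp hv).2.1 (Multiset.nodup_add.mp hn).2.1
    exact ⟨.cut _ _ _ _ _ h1 h4 h3, by simp only [den, h5]⟩
  | in_tensor_left A B π τ ρ _ ih =>
    obtain ⟨Δ, Γ, rfl, h1, h2, h3⟩ := derives_tensor_iff.mp hd
    obtain ⟨h4, h5⟩ := ih h1 (Multiset.nodup_add.mp hv).1 (Multiset.nodup_add.mp hn).1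
    exact ⟨.tensor _ _ _ _ _ _ h4 h2 h3, by simp only [den, h5]⟩
  | in_tensor_right A B π ρ τ _ ih =>
    obtain ⟨Δ, Γ, rfl, h1, h2, h3⟩ := derives_tensor_iff.mp hd
    obtain ⟨h4, h5⟩ := ih h2 (Multiset.nodup_add.mp hv).2.1 (Multiset.nodup_add.mp hn).2.1
    exact ⟨.tensor _ _ _ _ _ _ h1 h4 h3, by simp only [den, h5]⟩
  | in_par A B π τ _ ih =>
    obtain ⟨Γ, rfl, h1⟩ := derives_par_iff.mp hd
    obtain ⟨h4, h5⟩ := ih h1 hv hn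
    exact ⟨.par _ _ _ _ h4, h5⟩
  | in_bot π τ _ ih =>
    obtain ⟨Γ, rfl, h1⟩ := derives_bot_iff.mp hd
    obtain ⟨h4, h5⟩ := ih h1 hv hn
    exact ⟨.bot _ _ h4, h5⟩
  | in_mix_left π τ ρ _ ih =>
    obtain ⟨Δ, Γ, rfl, h1, h2, h3⟩ := derives_mix_iff.mp hd
    obtain ⟨h4, h5⟩ := ih h1 (Multiset.nodup_add.mp hv).1 (Multiset.nodup_add.mp hn).1
    exact ⟨.mix _ _ _ _ h4 h2 h3, by simp only [den, h5]⟩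
  | in_mix_right π ρ τ _ ih =>
    obtain ⟨Δ, Γ, rfl, h1, h2, h3⟩ := derives_mix_iff.mp hd
    obtain ⟨h4, h5⟩ := ih h2 (Multiset.nodup_add.mp hv).2.1 (Multiset.nodup_add.mp hn).2.1
    exact ⟨.mix _ _ _ _ h1 h4 h3, by simp only [den, h5]⟩

theorem Reduces.sound {π τ : Tree} {Γ : Multiset Formula} (h : Reduces n π τ)
    (hp : IsProof n π Γ) : IsProof n τ Γ ∧ den n π = den n τ := by
  induction h with
  | refl => exact ⟨hp, rfl⟩
  | tail _ h ih =>
    obtain ⟨h1, h2⟩ := h.sound ih.1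
    exact ⟨h1, ih.2.trans h2⟩

/-! ### Cut elimination terminates -/

/-- The number of connectives of a formula. -/
def Formula.size : Formula → ℕ
  | var _ _ => 0
  | nvar _ _ => 0
  | tensor A B => A.size + B.size + 1
  | par A B => A.size + B.size + 1
  | one => 0
  | bot => 0

theorem Formula.size_dual (A : Formula) : A.dual.size = A.size := by
  induction A <;> simp_all [dual, size]

/-- The number of rules of a tree. -/
def Tree.size : Tree → ℕ
  | ax _ _ _ => 1
  | cut _ π ρ => π.size + ρ.size + 1
  | tensor _ _ π ρ => π.size + ρ.size + 1
  | par _ _ π => π.size + 1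
  | one => 1
  | bot π => π.size + 1
  | mix π ρ => π.size + ρ.size + 1

/-- A cut of `A` in the conclusion of `π` can be moved above the last rule of `π`, to a cut against
`π₀` to which the context `F` is then applied. -/
structure Commutes (n : ℕ → ℕ) (A : Formula) (π π₀ : Tree) (F : Tree → Tree) : Prop where
  size_lt : π₀.size < π.size
  cutFree : π₀.CutFree
  cutStep : ∀ ρ, CutStep n A π ρ (F (Tree.cut A π₀ ρ))
  step : ∀ {σ τ}, Step n σ τ → Step n (F σ) (F τ)
  cutFree_context : ∀ {σ}, σ.CutFree → (F σ).CutFree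
  isProof : ∀ {σ Γ}, IsProof n (F σ) Γ → ∃ Γ', IsProof n σ Γ'

/-- The last rule of a tree introduces the formula. -/
inductive Principal : Formula → Tree → Prop
  | var (i j k : ℕ) : Principal (Formula.var i k) (Tree.ax i j k)
  | nvar (i j k : ℕ) : Principal (Formula.nvar i j) (Tree.ax i j k)
  | tensor (A B : Formula) (π ρ : Tree) : Principal (A.tensor B) (Tree.tensor A B π ρ)
  | par (A B : Formula) (π : Tree) : Principal (A.par B) (Tree.par A B π)
  | one : Principal Formula.one Tree.one
  | bot (π : Tree) : Principal Formula.bot (Tree.bot π)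

/-- Equal occurrences are not distinguished: when `A` equals the formula introduced by the last
rule, it is taken to be principal; otherwise it lies in the context of some premise, to which the
cut can move. -/
theorem principal_or_commutes {A : Formula} {Δ : Multiset Formula} {π : Tree}
    (h : Derives n π (A ::ₘ Δ)) (hcf : π.CutFree) :
    Principal A π ∨ ∃ π₀ F, Commutes n A π π₀ F := by
  have hA : A ∈ A ::ₘ Δ := Multiset.mem_cons_self _ _
  cases π with
  | ax i j k =>
    left
    rw [(derives_ax_iff.mp h).2] at hA
    rcases Multiset.mem_cons.mp hA with rfl | hA
    · exact .nvar _ _ _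
    · rw [Multiset.mem_singleton.mp hA]
      exact .var _ _ _
  | cut => exact hcf.elim
  | tensor B C π₁ π₂ =>
    obtain ⟨Δ₁, Δ₂, e, h1, h2, -⟩ := derives_tensor_iff.mp h
    rw [e, Multiset.mem_cons, Multiset.mem_add] at hA
    rcases hA with rfl | hA | hA
    · exact .inl (.tensor _ _ _ _)
    · obtain ⟨Δ', rfl⟩ := Multiset.exists_cons_of_mem hA
      refine .inr ⟨π₁, fun σ => Tree.tensor B C σ π₂, by simp only [Tree.size]; omega, hcf.1,
        fun ρ => .comm_tensor_left _ _ _ _ _ _ _ h1, .in_tensor_left _ _ _ _ _,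
        fun h => ⟨h, hcf.2⟩, IsProof.tensor_left⟩
    · obtain ⟨Δ', rfl⟩ := Multiset.exists_cons_of_mem hA
      refine .inr ⟨π₂, fun σ => Tree.tensor B C π₁ σ, by simp only [Tree.size]; omega, hcf.2,
        fun ρ => .comm_tensor_right _ _ _ _ _ _ _ h2, .in_tensor_right _ _ _ _ _,
        fun h => ⟨hcf.1, h⟩, IsProof.tensor_right⟩
  | par B C π =>
    obtain ⟨Δ₁, e, h1⟩ := derives_par_iff.mp h
    rw [e, Multiset.mem_cons] at hA
    rcases hA with rfl | hA
    · exact .inl (.par _ _ _)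
    · obtain ⟨Δ', rfl⟩ := Multiset.exists_cons_of_mem hA
      refine .inr ⟨π, fun σ => Tree.par B C σ, by simp only [Tree.size]; omega, hcf,
        fun ρ => .comm_par _ _ _ _ _ _ h1, .in_par _ _ _ _,
        fun h => h, IsProof.of_par⟩
  | one =>
    rw [derives_one_iff.mp h, Multiset.mem_singleton] at hA
    rw [hA]
    exact .inl .one
  | bot π =>
    obtain ⟨Δ₁, e, h1⟩ := derives_bot_iff.mp h
    rw [e, Multiset.mem_cons] at hA
    rcases hA with rfl | hA
    · exact .inl (.bot _)
    · obtain ⟨Δ', rfl⟩ := Multiset.exists_cons_of_mem hA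
      refine .inr ⟨π, fun σ => Tree.bot σ, by simp only [Tree.size]; omega, hcf,
        fun ρ => .comm_bot _ _ _ _ h1, .in_bot _ _,
        fun h => h, IsProof.of_bot⟩
  | mix π₁ π₂ =>
    obtain ⟨Δ₁, Δ₂, e, h1, h2, -⟩ := derives_mix_iff.mp h
    rw [e, Multiset.mem_add] at hA
    rcases hA with hA | hA
    · obtain ⟨Δ', rfl⟩ := Multiset.exists_cons_of_mem hA
      refine .inr ⟨π₁, fun σ => Tree.mix σ π₂, by simp only [Tree.size]; omega, hcf.1,
        fun ρ => .comm_mix_left _ _ _ _ _ h1, .in_mix_left _ _ _,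
        fun h => ⟨h, hcf.2⟩, IsProof.mix_left⟩
    · obtain ⟨Δ', rfl⟩ := Multiset.exists_cons_of_mem hA
      refine .inr ⟨π₂, fun σ => Tree.mix π₁ σ, by simp only [Tree.size]; omega, hcf.2,
        fun ρ => .comm_mix_right _ _ _ _ _ h2, .in_mix_right _ _ _,
        fun h => ⟨hcf.1, h⟩, IsProof.mix_right⟩

/-- The possible results of a key step on a cut of `A` between cut-free trees: a cut-free tree, or
two nested cuts of smaller formulas. -/
def KeyResult (A : Formula) (τ : Tree) : Prop :=
  τ.CutFree ∨ ∃ B C π₁ π₂ π₃, τ = Tree.cut C π₂ (Tree.cut B π₁ π₃) ∧ B.size < A.size ∧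
    C.size < A.size ∧ π₁.CutFree ∧ π₂.CutFree ∧ π₃.CutFree

/-- If `j = l`, the contexts of the two premises would be an atom and its negation, with the same
location. The side condition of cut forbids this once that location is non-empty. -/
theorem ax_ne_of_cut (hn : ∀ i, 0 < n i) {i j k l : ℕ} {Θ : Multiset Formula}
    (h : Derives n (Tree.cut (Formula.var i k) (Tree.ax i j k) (Tree.ax i k l)) Θ) : j ≠ l := by
  rintro rfl
  obtain ⟨Δ, Γ, rfl, h1, h2, h3⟩ := derives_cut_iff.mp h
  obtain rfl : Δ = {Formula.nvar i j} := (Multiset.cons_inj_right _).mp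
    ((derives_ax_iff.mp h1).2.trans (Multiset.cons_swap _ _ 0))
  obtain rfl : Γ = {Formula.var i j} := (Multiset.cons_inj_right _).mp (derives_ax_iff.mp h2).2
  have hm := locAt_mem (n := n) (i := i) j ⟨0, hn i⟩
  have h4 : locAt n i j ⟨0, hn i⟩ ∈ _ → _ ∉ _ := fun h => Finset.disjoint_left.mp h3 h
  simp [seqLoc, Formula.loc, hm] at h4

/-- The key steps, on a cut whose first premise introduces a positive formula. -/
theorem exists_cutStep_of_principal (hn : ∀ i, 0 < n i) {A : Formula} {π ρ : Tree}
    {Θ : Multiset Formula} (hA : Principal A π) (hA' : Principal A.dual ρ)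
    (h : Derives n (Tree.cut A π ρ) Θ) (hπ : π.CutFree) (hρ : ρ.CutFree)
    (hpos : (∃ i j, A = Formula.var i j) ∨ (∃ B C, A = Formula.tensor B C) ∨ A = Formula.one) :
    ∃ τ, CutStep n A π ρ τ ∧ KeyResult A τ := by
  rcases hpos with ⟨i, k, rfl⟩ | ⟨B, C, rfl⟩ | rfl
  · cases hA with | var _ j =>
    cases hA' with | nvar _ _ l =>
    exact ⟨_, .ax_ax _ _ _ _ (ax_ne_of_cut hn h), .inl trivial⟩
  · cases hA with | tensor _ _ π₁ π₂ =>
    cases hA' with | par _ _ π₃ =>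
    refine ⟨_, .tensor_par _ _ _ _ _, .inr ⟨_, _, _, _, _, rfl, ?_, ?_, hπ.1, hπ.2, hρ⟩⟩ <;>
      simp only [Formula.size] <;> omega
  · cases hA with | one =>
    cases hA' with | bot π =>
    exact ⟨_, .one_bot _, .inl hρ⟩

theorem exists_step_of_principal (hn : ∀ i, 0 < n i) {A : Formula} {π ρ : Tree}
    {Θ : Multiset Formula} (hA : Principal A π) (hA' : Principal A.dual ρ)
    (h : IsProof n (Tree.cut A π ρ) Θ) (hπ : π.CutFree) (hρ : ρ.CutFree) :
    ∃ τ, Step n (Tree.cut A π ρ) τ ∧ KeyResult A τ := by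
  -- For a negative formula the dual is positive, so the key step is applied with the premises
  -- exchanged.
  have neg : ((∃ i j, A.dual = Formula.var i j) ∨ (∃ B C, A.dual = Formula.tensor B C) ∨
      A.dual = Formula.one) → ∃ τ, Step n (Tree.cut A π ρ) τ ∧ KeyResult A τ := by
    intro hpos
    obtain ⟨τ, h1, h2⟩ := exists_cutStep_of_principal hn hA' (A.dual_dual.symm ▸ hA)
      (isProof_cut_symm h).1 hρ hπ hpos
    refine ⟨τ, .cut_symm _ _ _ _ h1, ?_⟩
    rwa [KeyResult, Formula.size_dual] at h2
  have pos := fun hpos => (exists_cutStep_of_principal hn hA hA' h.1 hπ hρ hpos).imp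
    fun τ h => h.imp_left (Step.cut _ _ _ _)
  cases A with
  | var i j => exact pos (.inl ⟨i, j, rfl⟩)
  | nvar i j => exact neg (.inl ⟨i, j, rfl⟩)
  | tensor A B => exact pos (.inr (.inl ⟨A, B, rfl⟩))
  | par A B => exact neg (.inr (.inl ⟨_, _, rfl⟩))
  | one => exact pos (.inr (.inr rfl))
  | bot => exact neg (.inr (.inr rfl))

theorem Reduces.map {F : Tree → Tree} (hF : ∀ {σ τ}, Step n σ τ → Step n (F σ) (F τ)) {σ τ : Tree}
    (h : Reduces n σ τ) : Reduces n (F σ) (F τ) :=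
  ReflTransGen.lift F (fun _ _ => hF) _ _ h

/-- Elimination of one cut between cut-free trees. -/
theorem exists_reduces_cut (hn : ∀ i, 0 < n i) (A : Formula) (π ρ : Tree) (Θ : Multiset Formula)
    (h : IsProof n (Tree.cut A π ρ) Θ) (hπ : π.CutFree) (hρ : ρ.CutFree) :
    ∃ τ, Reduces n (Tree.cut A π ρ) τ ∧ τ.CutFree := by
  have hd := h.1
  obtain ⟨Δ, Γ, -, h1, h2, -⟩ := derives_cut_iff.mp hd
  rcases principal_or_commutes h1 hπ with hA | ⟨π₀, F, hF⟩
  · rcases principal_or_commutes h2 hρ with hA' | ⟨ρ₀, F, hF⟩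
    · obtain ⟨τ, hs, hτ | ⟨B, C, π₁, π₂, π₃, rfl, hB, hC, hc1, hc2, hc3⟩⟩ :=
        exists_step_of_principal hn hA hA' h hπ hρ
      · exact ⟨τ, .single hs, hτ⟩
      · have hp := (hs.sound h).1
        obtain ⟨_, hp'⟩ := hp.cut_right
        -- The inner cut is eliminated first, so that the outer one again has cut-free premises.
        -- Both cut formulas are smaller than `A`, so the size of `τ₁` is irrelevant.
        obtain ⟨τ₁, hr1, hcf1⟩ := exists_reduces_cut hn B π₁ π₃ _ hp' hc1 hc3
        have hr1' := hr1.map (F := Tree.cut C π₂) (Step.in_cut_right _ _ _ _)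
        obtain ⟨τ₂, hr2, hcf2⟩ := exists_reduces_cut hn C π₂ τ₁ _ (hr1'.sound hp).1 hc2 hcf1
        exact ⟨τ₂, .head hs (hr1'.trans hr2), hcf2⟩
    -- Here the cut moves up on the right, and the recursive call has exchanged premises and the
    -- dual formula; both parts of the measure ignore this exchange.
    · have hs := Step.cut_symm A π ρ _ (hF.cutStep π)
      obtain ⟨_, hp⟩ := hF.isProof (hs.sound h).1
      have hlt := hF.size_lt
      obtain ⟨τ, hr, hcf⟩ := exists_reduces_cut hn A.dual ρ₀ π _ hp hF.cutFree hπ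
      exact ⟨F τ, .head hs (hr.map hF.step), hF.cutFree_context hcf⟩
  · have hs := Step.cut A π ρ _ (hF.cutStep ρ)
    obtain ⟨_, hp⟩ := hF.isProof (hs.sound h).1
    have hlt := hF.size_lt
    obtain ⟨τ, hr, hcf⟩ := exists_reduces_cut hn A π₀ ρ _ hp hF.cutFree hρ
    exact ⟨F τ, .head hs (hr.map hF.step), hF.cutFree_context hcf⟩
termination_by (A.size, π.size + ρ.size)
decreasing_by
  · exact Prod.Lex.left _ _ hB
  · exact Prod.Lex.left _ _ hC
  · rw [Formula.size_dual]
    exact Prod.Lex.right _ (by omega)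
  · exact Prod.Lex.right _ (by omega)

/-- Cut elimination. -/
theorem exists_reduces_cutFree (hn : ∀ i, 0 < n i) (π : Tree) :
    ∀ {Γ}, IsProof n π Γ → ∃ τ, Reduces n π τ ∧ τ.CutFree := by
  induction π with
  | ax i j k => exact fun _ => ⟨_, .refl, trivial⟩
  | cut A π ρ ih1 ih2 =>
    intro Γ h
    obtain ⟨π', hr1, hc1⟩ := ih1 h.cut_left.choose_spec
    obtain ⟨ρ', hr2, hc2⟩ := ih2 h.cut_right.choose_spec
    have hr := (hr1.map (F := fun σ => Tree.cut A σ ρ) (Step.in_cut_left _ _ _ _)).trans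
      (hr2.map (F := Tree.cut A π') (Step.in_cut_right _ _ _ _))
    obtain ⟨τ, hr', hc⟩ := exists_reduces_cut hn A π' ρ' Γ (Reduces.sound hr h).1 hc1 hc2
    exact ⟨τ, hr.trans hr', hc⟩
  | tensor A B π ρ ih1 ih2 =>
    intro Γ h
    obtain ⟨π', hr1, hc1⟩ := ih1 h.tensor_left.choose_spec
    obtain ⟨ρ', hr2, hc2⟩ := ih2 h.tensor_right.choose_spec
    exact ⟨_, (hr1.map (F := fun σ => Tree.tensor A B σ ρ) (Step.in_tensor_left _ _ _ _ _)).trans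
      (hr2.map (F := Tree.tensor A B π') (Step.in_tensor_right _ _ _ _ _)), hc1, hc2⟩
  | par A B π ih =>
    intro Γ h
    obtain ⟨π', hr, hc⟩ := ih h.of_par.choose_spec
    exact ⟨_, hr.map (F := Tree.par A B) (Step.in_par _ _ _ _), hc⟩
  | one => exact fun _ => ⟨_, .refl, trivial⟩
  | bot π ih =>
    intro Γ h
    obtain ⟨π', hr, hc⟩ := ih h.of_bot.choose_spec
    exact ⟨_, hr.map (F := Tree.bot) (Step.in_bot _ _), hc⟩
  | mix π ρ ih1 ih2 =>
    intro Γ h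
    obtain ⟨π', hr1, hc1⟩ := ih1 h.mix_left.choose_spec
    obtain ⟨ρ', hr2, hc2⟩ := ih2 h.mix_right.choose_spec
    exact ⟨_, (hr1.map (F := fun σ => Tree.mix σ ρ) (Step.in_mix_left _ _ _)).trans
      (hr2.map (F := Tree.mix π') (Step.in_mix_right _ _ _)), hc1, hc2⟩

end

end LocMLL

theorem mainTheorem9 (n : ℕ → ℕ) (Φ : LocMLL.Basis n) (Γ : Multiset LocMLL.Formula)
    (π : LocMLL.Tree) (hπ : LocMLL.IsProof n π Γ) :
    ((∀ i, 0 < n i) → ∃ π' : LocMLL.Tree, LocMLL.Reduces n π π' ∧ π'.CutFree) ∧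
    ∀ π' : LocMLL.Tree, LocMLL.Reduces n π π' → π'.CutFree →
      LocMLL.IsProof n π' Γ ∧
      ∃ a a' : LocMLL.Project (ℕ × ℕ),
        LocMLL.interp Φ π = some a ∧ LocMLL.interp Φ π' = some a' ∧ a.Same a' := by
  refine ⟨fun hn => LocMLL.exists_reduces_cutFree hn π hπ, fun π' hr hc => ?_⟩
  obtain ⟨hπ', hden⟩ := hr.sound hπ
  obtain ⟨d, hd⟩ := LocMLL.exists_den_of_cutFree n π' hc
  -- The denotation `d` found for the cut-free reduct is also that of `π`, which is what makes the
  -- interpretation of `π` defined.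
  obtain ⟨a, ha, had⟩ := LocMLL.interp_denotes Φ hπ.1 (hden.trans hd)
  obtain ⟨a', ha', had'⟩ := LocMLL.interp_denotes Φ hπ'.1 hd
  exact ⟨hπ', a, a', ha, ha', had.same had'⟩
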